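/- Let $0<\alpha<1$ and let $$\mathcal K_\alpha=\{(x_1,x_2,x_3)\in\mathbb R^3:\ x_1\ge 0,\ x_3\ge 0,\ x_1^{\alpha}x_3^{1-\alpha}\ge |x_2|\}$$ be the power cone. A quasi-realization of a stationary stochastic process with values in a finite alphabet $\mathbb M$ and with word probabilities $p(\mathbf u)$ ($\mathbf u\in\mathbb M^*$) is a quadruple $(\mathcal V,\pi,D,\tau)$ of a real vector space $\mathcal V$, a monoid homomorphism $D:\mathbf u\mapsto D^{(\mathbf u)}$ from words to linear maps of $\mathcal V$, and $\pi\in\mathcal V^*$, $\tau\in\mathcal V$ with $\pi\overline D=\pi$ and $\overline D\tau=\tau$, where $\overline D=\sum_{u\in\mathbb M}D^{(u)}$, such that $p(\mathbf u)=\pi D^{(\mathbf u)}\tau$ for all $\mathbf u$. It is regular if $\dim\mathcal V$ is minimal among all quasi-realizations of $p$. A stable cone of it is a convex cone $\mathcal C\subseteq\mathcal V$ with $\tau\in\mathcal C$, $D^{(\mathbf u)}(\mathcal C)\subseteq\mathcal C$ for all $\mathbf u$, and $\pi(x)\ge 0$ for all $x\in\mathcal C$. A finite-dimensional quantum realization of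 $p$ is a quasi-realization of $p$ of the form $(\mathcal B(\mathbb C^d)^{\mathrm{sa}},\,X\mapsto\operatorname{tr}(\rho X),\,\mathbb E,\,\mathbb 1)$, where $\rho$ is a density operator and the maps $\mathbb E^{(u)}$, $u\in\mathbb M$, are completely positive (so that $\sum_u\mathbb E^{(u)}$ is unital and leaves $\rho$ invariant). Then there exist $\nu'\in\mathbb R$, $a,b>0$ and $m_0,\mu_0\in\mathbb R^3$ such that, for the linear maps of $\mathbb R^3$ $$D_0=\nu' m_0\mu_0^T,\quad D_1=\nu'\operatorname{diag}\bigl(a,1,a^{\frac{\alpha}{\alpha-1}}\bigr),\quad D_2=\nu'\operatorname{diag}\bigl(b,1,b^{\frac{\alpha}{\alpha-1}}\bigr),\quad D_3=\nu'\operatorname{diag}(1,-1,1),$$ $D_0$ has rank one and $\overline D=D_0+D_1+D_2+D_3$ has, up to scaling, unique left and right eigenvectors $\pi$ and $\tau$ with eigenvalue $1$; and, with a suitable scaling of $\pi$ and $\tau$ and with $D$ the homomorphism on words over $\{0,1,2,3\}$ generated by $D_0,\dots,D_3$: 1. $(\mathbb R^3,\pi,D,\tau)$ is a regular quasi-realization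 of a stationary stochastic process with four letters; 2. $\mathcal K_\alpha$ is a closed stable cone of $(\mathbb R^3,\pi,D,\tau)$, and it is the only one; 3. if $\alpha$ is irrational, then $\mathcal K_\alpha$ is not semi-algebraic, and the process has no finite-dimensional quantum realization. -/

import Mathlib

/-- The letter probabilities `p(u) = Pr (Y_t = u₁, …, Y_{t+ℓ-1} = u_ℓ)`, for all finite words `u`
and independently of `t`, of some stochastic process `(Y_t)` with values in `M`. -/
def IsStationaryProcess {M : Type} [MeasurableSpace M] (p : FreeMonoid M → ℝ) : Prop :=
  ∃ (Ω : Type) (_ : MeasurableSpace Ω) (P : MeasureTheory.Measure Ω) (Y : ℕ → Ω → M),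
    MeasureTheory.IsProbabilityMeasure P ∧ (∀ t, Measurable (Y t)) ∧
    ∀ (t : ℕ) (w : FreeMonoid M),
      P.real {ω | ∀ i : Fin w.toList.length, Y (t + i) ω = w.toList.get i} = p w

/-- The data `(V, π, D, τ)` of a quasi-realization over the alphabet `M`: a monoid homomorphism
from words to linear maps and fixed vectors of `∑ u, D u` on both sides. -/
structure QuasiRealization (M : Type) [Fintype M] (V : Type) [AddCommGroup V] [Module ℝ V] where
  π : Module.Dual ℝ V
  D : FreeMonoid M →* Module.End ℝ V
  τ : V
  π_fixed : π ∘ₗ (∑ u, D (FreeMonoid.of u)) = π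
  τ_fixed : (∑ u, D (FreeMonoid.of u)) τ = τ

namespace QuasiRealization

variable {M : Type} [Fintype M] {V : Type} [AddCommGroup V] [Module ℝ V]

/-- The map `D̄ = ∑ u, D u`. -/
def total (R : QuasiRealization M V) : Module.End ℝ V := ∑ u, R.D (FreeMonoid.of u)

/-- The word function `u ↦ π D⁽ᵘ⁾ τ`. -/
def wordProb (R : QuasiRealization M V) (w : FreeMonoid M) : ℝ := R.π (R.D w R.τ)

/-- `R` is a quasi-realization of the stationary process with word probabilities `p`. -/
def Realizes [MeasurableSpace M] (R : QuasiRealization M V) (p : FreeMonoid M → ℝ) : Prop :=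
  IsStationaryProcess p ∧ ∀ w, p w = R.wordProb w

/-- `R` has minimal dimension among all quasi-realizations with the same word function. -/
def IsRegular (R : QuasiRealization M V) : Prop :=
  ∀ (W : Type) [AddCommGroup W] [Module ℝ W] (S : QuasiRealization M W),
    S.wordProb = R.wordProb → Module.rank ℝ V ≤ Module.rank ℝ W

/-- `C` is a convex cone with `τ ∈ C`, `D⁽ᵘ⁾ C ⊆ C` for every word, and `π` in the dual cone. -/
structure IsStableCone (R : QuasiRealization M V) (C : Set V) : Prop where
  isConvexCone : ∃ K : ConvexCone ℝ V, (K : Set V) = C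
  τ_mem : R.τ ∈ C
  map_mem : ∀ (w : FreeMonoid M), ∀ x ∈ C, R.D w x ∈ C
  π_nonneg : ∀ x ∈ C, 0 ≤ R.π x

end QuasiRealization

open scoped Matrix.Norms.L2Operator MatrixOrder ComplexOrder in
/-- `p` has a finite-dimensional completely positive (quantum) realization: a quasi-realization on
the Hermitian operators on `ℂ ^ d` given by a density operator `ρ`, completely positive maps
`E u`, and the identity operator. Unitality of `∑ u, E u` and invariance of `ρ` are the fixed point
relations of the quasi-realization. -/
def HasQuantumRealization {M : Type} [Fintype M] [MeasurableSpace M]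
    (p : FreeMonoid M → ℝ) : Prop :=
  ∃ (d : ℕ) (R : QuasiRealization M (selfAdjoint (Matrix (Fin d) (Fin d) ℂ)))
    (ρ : Matrix (Fin d) (Fin d) ℂ)
    (E : M → CompletelyPositiveMap (Matrix (Fin d) (Fin d) ℂ) (Matrix (Fin d) (Fin d) ℂ)),
    R.Realizes p ∧
    ρ.PosSemidef ∧ ρ.trace = 1 ∧
    (∀ X, ((R.π X : ℝ) : ℂ) = (ρ * (X : Matrix (Fin d) (Fin d) ℂ)).trace) ∧
    (∀ u X, (R.D (FreeMonoid.of u) X : Matrix (Fin d) (Fin d) ℂ) = E u X) ∧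
    (R.τ : Matrix (Fin d) (Fin d) ℂ) = 1

/-- Semi-algebraic subsets of `ℝ ^ n`: finite unions of sets given by finitely many polynomial
equations and strict polynomial inequalities. -/
def IsSemialgebraic {n : ℕ} (S : Set (Fin n → ℝ)) : Prop :=
  ∃ F : Finset (Finset (MvPolynomial (Fin n) ℝ) × Finset (MvPolynomial (Fin n) ℝ)),
    S = {x | ∃ A ∈ F, (∀ f ∈ A.1, MvPolynomial.eval x f = 0) ∧
      ∀ g ∈ A.2, 0 < MvPolynomial.eval x g}

/-- The power cone with exponent `α`. -/
def powerCone (α : ℝ) : Set (Fin 3 → ℝ) :=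
  {x | 0 ≤ x 0 ∧ 0 ≤ x 2 ∧ |x 1| ≤ x 0 ^ α * x 2 ^ (1 - α)}

/-- The matrices `D₀, D₁, D₂, D₃`. -/
noncomputable def powerMaps (α ν a b : ℝ) (m₀ μ₀ : Fin 3 → ℝ) :
    Fin 4 → Matrix (Fin 3) (Fin 3) ℝ :=
  ![ν • Matrix.vecMulVec m₀ μ₀,
    ν • Matrix.diagonal ![a, 1, a ^ (α / (α - 1))],
    ν • Matrix.diagonal ![b, 1, b ^ (α / (α - 1))],
    ν • Matrix.diagonal ![1, -1, 1]]

/-! Write γ = α / (α - 1). By the weighted AM-GM inequality the power cone is the intersection of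
the half-spaces |x₁| ≤ α s x₀ + (1 - α) s ^ γ x₂ over s > 0, and it is the closed convex cone
spanned by the rays (t, ±1, t ^ γ) over t > 0. The maps diag(t, 1, t ^ γ) move both families along
their parameter and D₃ exchanges the signs. D₀ maps everything to the ray of (1, 1, 1), by a
positive multiple of the supporting functional (α, 1, 1 - α). Since e and e ^ (-√2) generate a dense
multiplicative semigroup, the orbit of τ fills the boundary rays densely, so a closed stable cone
contains the power cone (`powerCone_subset`); dually, the orbit of π forces every stable cone into
it (`subset_powerCone`). The same orbits contain three independent vectors and three independent
functionals, which gives regularity.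

A quantum realization writes p(vw) as tr(A_w B_v) with positive semidefinite A_w and B_v
(`HasQuantumRealization.exists_psd_factorization`). On the orbits above, after normalization, this
factors the slack function α t s - 1 + (1 - α) (t s) ^ γ for t, s in the dense semigroup; trace
bounds and compactness extend the factorization to all t, s > 0 (`exists_gram_of_mem_closure`).

Such a factorization cannot exist (`not_exists_gram_factorization`). At s = 1/t the slack vanishes,
so the two factors are orthogonal there, and every derivation of t ↦ G(t)ᴴ G(t) has trace zero
against the second factor at 1/t. If γ is irrational, t and t ^ γ are algebraically independent, so
some derivation has δ(t) = 1 and δ(t ^ γ) = 0. Applied to the slack at fixed s it gives α s, which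
is nonzero at s = 1/t. The derivation acts on a quotient field of the ring of complex sequences, so
no regularity of G and H is needed. The same independence shows that the cone is not semi-algebraic.
-/

/-! ### Derivations dual to algebraically independent elements -/

/-- In characteristic zero, the elements of a transcendence basis have dual derivations. -/
theorem IsTranscendenceBasis.exists_derivation {K F ι : Type*} [Field K] [Field F] [Algebra K F]
    [CharZero K] {v : ι → F} (hv : IsTranscendenceBasis K v) (i : ι) :
    ∃ δ : Derivation K F F, δ (v i) = 1 ∧ ∀ j, j ≠ i → δ (v j) = 0 := by
  classical
  let P := MvPolynomial ι K
  let : Algebra P F := (MvPolynomial.aeval v : P →ₐ[K] F).toRingHom.toAlgebra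
  have : IsScalarTower K P F := .of_algebraMap_eq' (MvPolynomial.aeval v : P →ₐ[K] F).comp_algebraMap.symm
  have hinj : Function.Injective (algebraMap P F) := hv.1
  have : FaithfulSMul P F := (faithfulSMul_iff_algebraMap_injective P F).2 hinj
  let : Algebra (FractionRing P) F := FractionRing.liftAlgebra P F
  have : IsScalarTower P (FractionRing P) F := inferInstance
  have : Algebra.IsAlgebraic P F := by
    have h := hv.isAlgebraic
    refine ⟨fun x => ?_⟩
    obtain ⟨q, hq0, hq⟩ := h.isAlgebraic x
    let e := hv.1.aevalEquiv
    refine ⟨q.map e.symm.toRingEquiv.toRingHom, ?_, ?_⟩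
    · rwa [Polynomial.map_ne_zero_iff e.symm.injective]
    · rw [Polynomial.aeval_def, Polynomial.eval₂_map]
      rw [Polynomial.aeval_def] at hq
      rw [← hq]
      congr 1
      ext y
      obtain ⟨z, rfl⟩ := e.surjective y
      simp [e]
      rfl
  have : Algebra.IsAlgebraic (FractionRing P) F :=
    (IsFractionRing.comap_isAlgebraic_iff (A := P) (K := FractionRing P) (C := F)).1 inferInstance
  have : CharZero P := inferInstance
  have : CharZero (FractionRing P) := inferInstance
  -- A localization followed by a separable algebraic extension is formally étale, so the
  -- differentials of `F` over `K` are `F ⊗ Ω[P⁄K]`, free on the dXⱼ. The derivation sought is the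
  -- coordinate of dXᵢ.
  have : Algebra.FormallyEtale P (FractionRing P) := .of_isLocalization (nonZeroDivisors P)
  have : Algebra.FormallyEtale (FractionRing P) F := .of_isSeparable _ _
  have : Algebra.FormallyEtale P F := .comp P (FractionRing P) F
  let b := (KaehlerDifferential.mvPolynomialBasis K ι).baseChange F
  let e := KaehlerDifferential.tensorKaehlerEquivOfFormallyEtale K P F
  let δ : Derivation K F F := (b.coord i ∘ₗ e.symm.toLinearMap).compDer (KaehlerDifferential.D K F)
  have hδ : ∀ j, δ (v j) = if j = i then 1 else 0 := by
    intro j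
    have h1 : v j = algebraMap P F (MvPolynomial.X j) := by
      change _ = MvPolynomial.aeval v _
      simp
    change b.coord i (e.symm (KaehlerDifferential.D K F (v j))) = _
    rw [h1, KaehlerDifferential.tensorKaehlerEquivOfFormallyEtale_symm_D_algebraMap]
    have h2 : (1 : F) ⊗ₜ[P] KaehlerDifferential.D K P (MvPolynomial.X j) = b j := by
      simp [b, P]
    rw [h2]
    simp [Finsupp.single_apply]
  exact ⟨δ, by simp [hδ], fun j hj => by simp [hδ, hj]⟩

theorem AlgebraicIndependent.exists_derivation {K F ι : Type*} [Field K] [Field F] [Algebra K F]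
    [CharZero K] {v : ι → F} (hv : AlgebraicIndependent K v) (i : ι) :
    ∃ δ : Derivation K F F, δ (v i) = 1 ∧ ∀ j, j ≠ i → δ (v j) = 0 := by
  obtain ⟨t, hst, ht⟩ := exists_isTranscendenceBasis_superset
    (AlgebraicIndependent.coe_range hv)
  obtain ⟨δ, h1, h2⟩ := ht.exists_derivation ⟨v i, hst ⟨i, rfl⟩⟩
  refine ⟨δ, h1, fun j hj => h2 ⟨v j, hst ⟨j, rfl⟩⟩ fun h => hj (hv.injective ?_)⟩
  simpa using congrArg Subtype.val h

/-! ### Fields of sequences and the independence of t and t ^ γ -/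

/-- A field of sequences modulo an ideal that contains all finitely supported sequences. -/
theorem exists_field_of_sequences (K : Type) [Field K] :
    ∃ (F : Type) (_ : Field F) (_ : Algebra K F) (Φ : (ℕ → K) →ₐ[K] F),
      ∀ f, Φ f = 0 → ∃ᶠ n in Filter.atTop, f n = 0 := by
  let I : Ideal (ℕ → K) :=
    { carrier := {f | ∀ᶠ n in Filter.atTop, f n = 0}
      add_mem' := fun {f g} hf hg => by
        filter_upwards [hf, hg] with n h1 h2
        simp [h1, h2]
      zero_mem' := by simp
      smul_mem' := fun c f hf => by
        filter_upwards [hf] with n h1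
        simp [h1] }
  have hI : I ≠ ⊤ := by
    intro h
    have h1 : (1 : ℕ → K) ∈ I := by rw [h]; trivial
    obtain ⟨n, hn⟩ := Filter.Eventually.exists (show ∀ᶠ n in Filter.atTop, (1 : ℕ → K) n = 0 from h1)
    simp at hn
  obtain ⟨m, hm, hIm⟩ := Ideal.exists_le_maximal I hI
  refine ⟨(ℕ → K) ⧸ m, Ideal.Quotient.field m, inferInstance, Ideal.Quotient.mkₐ K m, ?_⟩
  intro f hf
  have hfm : f ∈ m := Ideal.Quotient.eq_zero_iff_mem.1 hf
  by_contra hcon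
  rw [Filter.not_frequently] at hcon
  apply hm.ne_top
  rw [Ideal.eq_top_iff_one]
  -- An eventually nonvanishing sequence is a unit modulo `I`, so it lies in no maximal ideal above
  -- `I`.
  have h1 : (1 - (fun n => (f n)⁻¹) * f : ℕ → K) ∈ I := by
    change ∀ᶠ n in Filter.atTop, _ = _
    filter_upwards [hcon] with n hn
    simp [hn]
  have h2 := m.add_mem (hIm h1) (m.mul_mem_left (fun n => (f n)⁻¹) hfm)
  simpa using h2

/-- A linear relation that holds for the terms of a sequence holds for its class. -/
theorem linear_relation_of_sequence {K F ι : Type*} [Field K] [Field F] [Algebra K F] [Fintype ι]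
    (Φ : (ℕ → K) →ₐ[K] F) (y : ι → F) (x : ι → ℕ → K)
    (h : ∀ n, ∑ i, x i n • y i = 0) : ∑ i, Φ (x i) * y i = 0 := by
  -- In a `K`-basis of the span of the `y i`, the hypothesis becomes finitely many relations between
  -- the sequences `x i` with coefficients in `K`, and `Φ` preserves these.
  let W := Submodule.span K (Set.range y)
  have : FiniteDimensional K W := FiniteDimensional.span_of_finite K (Set.finite_range y)
  let e := Module.finBasis K W
  let y' : ι → W := fun i => ⟨y i, Submodule.subset_span ⟨i, rfl⟩⟩
  have hy : ∀ i, y i = ∑ j, e.repr (y' i) j • (e j : F) := by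
    intro i
    have := congrArg W.subtype (e.sum_repr (y' i))
    rw [map_sum] at this
    simp only [map_smul] at this
    exact this.symm
  have hx : ∀ j, ∑ i, e.repr (y' i) j • x i = 0 := by
    intro j
    ext n
    have h1 : ∑ i, x i n • y' i = 0 := by
      apply Subtype.ext
      simpa [y'] using h n
    have h2 := congrArg (fun w => e.repr w j) h1
    simp only [map_sum, map_smul, Finsupp.coe_finsetSum, Finset.sum_apply, Finsupp.smul_apply,
      map_zero, Finsupp.coe_zero, Pi.zero_apply] at h2
    simpa [mul_comm] using h2
  calc ∑ i, Φ (x i) * y i = ∑ i, ∑ j, Φ (e.repr (y' i) j • x i) * (e j : F) := by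
        refine Finset.sum_congr rfl fun i _ => ?_
        conv_lhs => rw [hy i]
        rw [Finset.mul_sum]
        refine Finset.sum_congr rfl fun j _ => ?_
        rw [map_smul, smul_mul_assoc, mul_smul_comm]
    _ = ∑ j, Φ (∑ i, e.repr (y' i) j • x i) * (e j : F) := by
        rw [Finset.sum_comm]
        simp only [map_sum, Finset.sum_mul]
    _ = 0 := by simp [hx]

/-- A polynomial relation between `t` and `t ^ γ` for arbitrarily large `t` is trivial if `γ` is
irrational. -/
theorem eventually_eval_rpow_ne_zero {𝕜 : Type*} [RCLike 𝕜] {γ : ℝ} (hγ : Irrational γ)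
    {P : MvPolynomial (Fin 2) 𝕜} (hP : P ≠ 0) :
    ∀ᶠ t : ℝ in Filter.atTop,
      MvPolynomial.eval ![(t : 𝕜), ((t ^ γ : ℝ) : 𝕜)] P ≠ 0 := by
  -- The growth exponent of a monomial on the curve (t, t ^ γ). Irrationality makes it injective, so
  -- a single monomial dominates as t → ∞.
  let ex : (Fin 2 →₀ ℕ) → ℝ := fun m => m 0 + γ * m 1
  have hex : Function.Injective ex := by
    intro m m' h
    simp only [ex] at h
    have h1 : m 1 = m' 1 := by
      by_contra hne
      have hne' : ((m 1 : ℤ) - m' 1 : ℝ) ≠ 0 := by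
        rw [sub_ne_zero]
        exact_mod_cast hne
      apply (irrational_iff_ne_rational γ).1 hγ ((m' 0 : ℤ) - m 0) ((m 1 : ℤ) - m' 1)
      · exact_mod_cast hne'
      · rw [eq_div_iff (by exact_mod_cast hne')]
        push_cast
        linarith
    have h0 : m 0 = m' 0 := by
      rw [h1] at h
      exact_mod_cast add_right_cancel h
    ext i
    fin_cases i <;> simp [h0, h1]
  obtain ⟨m, hm, hmax⟩ := P.support.exists_max_image ex
    (MvPolynomial.support_nonempty.2 hP)
  have hlim : Filter.Tendsto (fun t : ℝ => ∑ k ∈ P.support,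
      P.coeff k * ((t ^ (ex k - ex m) : ℝ) : 𝕜)) Filter.atTop (nhds (P.coeff m)) := by
    have h1 : ∀ k ∈ P.support, Filter.Tendsto (fun t : ℝ => P.coeff k *
        ((t ^ (ex k - ex m) : ℝ) : 𝕜)) Filter.atTop (nhds (if k = m then P.coeff k else 0)) := by
      intro k hk
      by_cases hkm : k = m
      · simp [hkm]
      · have hlt : ex k < ex m := lt_of_le_of_ne (hmax k hk) (hex.ne hkm)
        have h2 := tendsto_rpow_neg_atTop (sub_pos.2 hlt)
        have h3 := ((RCLike.continuous_ofReal (K := 𝕜)).tendsto 0).comp h2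
        simp only [RCLike.ofReal_zero] at h3
        simpa [hkm, Function.comp_def] using h3.const_mul (P.coeff k)
    have h2 := tendsto_finsetSum _ h1
    rwa [Finset.sum_ite_eq' P.support m, if_pos hm] at h2
  have hne := hlim.eventually_ne (MvPolynomial.mem_support_iff.1 hm)
  filter_upwards [hne, Filter.eventually_gt_atTop 0] with t ht ht0 h0
  apply ht
  have h1 : ∀ k, P.coeff k * ((t ^ (ex k - ex m) : ℝ) : 𝕜)
      = P.coeff k * ((t : 𝕜) ^ (k 0) * ((t ^ γ : ℝ) : 𝕜) ^ (k 1)) * ((t ^ (-ex m) : ℝ) : 𝕜) := by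
    intro k
    rw [mul_assoc]
    congr 1
    rw [← RCLike.ofReal_pow, ← RCLike.ofReal_pow, ← RCLike.ofReal_mul, ← RCLike.ofReal_mul]
    congr 1
    rw [sub_eq_add_neg, Real.rpow_add ht0, Real.rpow_add ht0, Real.rpow_natCast,
      Real.rpow_mul ht0.le, Real.rpow_natCast]
  rw [Finset.sum_congr rfl fun k _ => h1 k, ← Finset.sum_mul]
  rw [MvPolynomial.eval_eq'] at h0
  simp only [Fin.prod_univ_two, Matrix.cons_val_zero, Matrix.cons_val_one] at h0
  rw [h0, zero_mul]


/-! ### The obstruction to a positive semidefinite factorization -/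

theorem Matrix.trace_mul_eq_sum {R n : Type*} [Fintype n] [NonUnitalNonAssocSemiring R]
    (A B : Matrix n n R) : (A * B).trace = ∑ i, ∑ j, A i j * B j i := by
  simp only [Matrix.trace, Matrix.diag_apply, Matrix.mul_apply]

open Matrix in
open scoped ComplexOrder in
/-- The matrices `Gᴴ G` cannot factor the slack function of a non-algebraic power cone. -/
theorem not_exists_gram_factorization {d : ℕ} {α γ : ℝ} (hα : α ≠ 0) (hγ : Irrational γ)
    (G H : ℝ → Matrix (Fin d) (Fin d) ℂ)
    (h : ∀ t s, 0 < t → 0 < s → ((G t)ᴴ * G t * ((H s)ᴴ * H s)).trace =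
      ((α * (t * s) - 1 + (1 - α) * (t * s) ^ γ : ℝ) : ℂ)) : False := by
  obtain ⟨F, _, _, Φ, hΦ⟩ := exists_field_of_sequences ℂ
  let t : ℕ → ℝ := fun n => n + 1
  have ht : ∀ n, 0 < t n := fun n => by positivity
  have htop : Filter.Tendsto t Filter.atTop Filter.atTop :=
    Filter.tendsto_atTop_add_const_right _ _ tendsto_natCast_atTop_atTop
  let T : ℕ → ℂ := fun n => t n
  let U : ℕ → ℂ := fun n => ((t n ^ γ : ℝ) : ℂ)
  have hind : AlgebraicIndependent ℂ ![Φ T, Φ U] := by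
    rw [algebraicIndependent_iff]
    intro P hP
    by_contra hP0
    have h1 : MvPolynomial.aeval ![Φ T, Φ U] = Φ.comp (MvPolynomial.aeval ![T, U]) :=
      MvPolynomial.algHom_ext fun i => by fin_cases i <;> simp
    replace h1 := DFunLike.congr_fun h1 P
    rw [AlgHom.comp_apply] at h1
    obtain ⟨n, hn1, hn2⟩ := ((hΦ _ (h1 ▸ hP)).and_eventually
      (htop.eventually (eventually_eval_rpow_ne_zero hγ hP0))).exists
    apply hn2
    rw [← hn1]
    have h2 : (Pi.evalAlgHom ℂ (fun _ : ℕ => ℂ) n).comp (MvPolynomial.aeval ![T, U]) =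
        MvPolynomial.aeval ![(t n : ℂ), ((t n ^ γ : ℝ) : ℂ)] :=
      MvPolynomial.algHom_ext fun i => by fin_cases i <;> simp [T, U]
    exact (DFunLike.congr_fun h2 P).symm
  -- This is the partial derivative in T with U = T ^ γ held fixed. The derivative along the curve
  -- would be useless: the slack vanishes to second order at t s = 1.
  obtain ⟨δ, hδT, hδU⟩ := hind.exists_derivation 0
  replace hδU := hδU 1 (by decide)
  simp only [Matrix.cons_val_zero, Matrix.cons_val_one] at hδT hδU
  let g : Matrix (Fin d) (Fin d) F := .of fun i j => Φ fun n => G (t n) i j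
  let g' : Matrix (Fin d) (Fin d) F := .of fun i j => Φ fun n => (G (t n))ᴴ i j
  let k : Matrix (Fin d) (Fin d) F := .of fun i j => Φ fun n => H (t n)⁻¹ i j
  let k' : Matrix (Fin d) (Fin d) F := .of fun i j => Φ fun n => (H (t n)⁻¹)ᴴ i j
  -- The trace at (t, 1/t) is the squared Hilbert-Schmidt norm of G(t) H(1/t)ᴴ, and the slack there
  -- is α - 1 + (1 - α) = 0.
  have horth : ∀ n, G (t n) * (H (t n)⁻¹)ᴴ = 0 := by
    intro n
    rw [← trace_conjTranspose_mul_self_eq_zero_iff]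
    have h1 := h (t n) (t n)⁻¹ (ht n) (inv_pos.2 (ht n))
    rw [mul_inv_cancel₀ (ht n).ne', Real.one_rpow] at h1
    rw [conjTranspose_mul, conjTranspose_conjTranspose, Matrix.mul_assoc, trace_mul_comm,
      Matrix.mul_assoc, Matrix.mul_assoc, ← Matrix.mul_assoc (G (t n))ᴴ, h1]
    simp
  have mulΦ : ∀ X Y : ℕ → Matrix (Fin d) (Fin d) ℂ,
      (Matrix.of fun i j => Φ fun n => X n i j) * (Matrix.of fun i j => Φ fun n => Y n i j) =
      Matrix.of fun i j => Φ fun n => (X n * Y n) i j := by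
    intro X Y
    ext i j
    simp only [Matrix.mul_apply, Matrix.of_apply, ← map_mul, ← map_sum]
    congr 1
    ext n
    simp
  have hgk : g * k' = 0 := by
    rw [mulΦ]
    ext i j
    simp only [horth, Matrix.of_apply, Matrix.zero_apply]
    exact map_zero Φ
  have hkg : k * g' = 0 := by
    have h1 : ∀ n, H (t n)⁻¹ * (G (t n))ᴴ = 0 := fun n => by
      rw [← conjTranspose_eq_zero, conjTranspose_mul, conjTranspose_conjTranspose, horth]
    rw [mulΦ]
    ext i j
    simp only [h1, Matrix.of_apply, Matrix.zero_apply]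
    exact map_zero Φ
  have hδ : (g' * g).map δ = g'.map δ * g + g' * g.map δ := by
    ext i j
    simp only [Matrix.map_apply, Matrix.mul_apply, Matrix.add_apply, map_sum, Derivation.leibniz,
      smul_eq_mul, ← Finset.sum_add_distrib]
    exact Finset.sum_congr rfl fun l _ => by ring
  -- Each term of the Leibniz rule keeps one underived factor, `g` or `g'`, which meets `k'` or `k`
  -- cyclically and annihilates it.
  have hzero : ((g' * g).map δ * (k' * k)).trace = 0 := by
    rw [hδ, Matrix.add_mul, trace_add, Matrix.mul_assoc _ g, ← Matrix.mul_assoc g, hgk,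
      Matrix.mul_assoc g', trace_mul_comm g', Matrix.mul_assoc _ _ g', Matrix.mul_assoc k' k,
      hkg]
    simp
  have hrel : ∀ n, ∑ i, ∑ j, ((H (t n)⁻¹)ᴴ * H (t n)⁻¹) j i • (g' * g) i j =
      (α * (t n)⁻¹ : ℂ) • Φ T - 1 + ((1 - α) * ((t n)⁻¹ ^ γ : ℝ) : ℂ) • Φ U := by
    intro n
    rw [mulΦ]
    simp only [Matrix.of_apply, ← map_smul, ← map_sum]
    rw [← map_one Φ, ← map_sub, ← map_add]
    congr 1
    ext m
    have h1 := h (t m) (t n)⁻¹ (ht m) (inv_pos.2 (ht n))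
    rw [Matrix.trace_mul_eq_sum] at h1
    rw [Real.mul_rpow (ht m).le (inv_pos.2 (ht n)).le] at h1
    simp only [Finset.sum_apply, Pi.smul_apply, smul_eq_mul, Pi.add_apply, Pi.sub_apply,
      Pi.one_apply, T, U]
    simp only [mul_comm (((H (t n)⁻¹)ᴴ * H (t n)⁻¹) _ _)]
    rw [h1]
    push_cast
    ring
  -- For fixed n the second factor is a matrix of complex constants, so `δ` passes through it.
  have hrel' : ∀ n, ∑ i, ∑ j, ((H (t n)⁻¹)ᴴ * H (t n)⁻¹) j i • (g' * g).map δ i j =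
      (α * (t n)⁻¹ : ℂ) • (1 : F) := by
    intro n
    have h1 := congrArg δ (hrel n)
    simpa [hδT, hδU] using h1
  -- The relations for the separate constants 1/tₙ combine into one in which the second factor is
  -- the class of H(1/t)ᴴ H(1/t). The index `none` carries the right hand side.
  have hlin := linear_relation_of_sequence Φ
    (fun q : Option (Fin d × Fin d) => q.elim (-1) fun q => (g' * g).map δ q.1 q.2)
    (fun q n => q.elim (α * (t n)⁻¹ : ℂ) fun q => ((H (t n)⁻¹)ᴴ * H (t n)⁻¹) q.2 q.1)
    (fun n => by
      rw [Fintype.sum_option, Fintype.sum_prod_type]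
      simp only [Option.elim_none, Option.elim_some]
      rw [hrel' n]
      simp)
  rw [Fintype.sum_option, Fintype.sum_prod_type] at hlin
  simp only [Option.elim_none, Option.elim_some] at hlin
  have h2 : ∑ i, ∑ j, (Φ fun n => ((H (t n)⁻¹)ᴴ * H (t n)⁻¹) j i) * (g' * g).map δ i j = 0 := by
    rw [← hzero, Matrix.trace_mul_eq_sum, mulΦ (fun n => (H (t n)⁻¹)ᴴ)]
    exact Finset.sum_congr rfl fun i _ => Finset.sum_congr rfl fun j _ => mul_comm _ _
  rw [h2, add_zero, mul_neg_one, neg_eq_zero] at hlin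
  obtain ⟨n, hn⟩ := (hΦ _ hlin).exists
  have := (ht n).ne'
  simp [hα, this] at hn

/-! ### Geometry of the power cone -/

/-- Tangent planes of the weighted geometric mean. -/
theorem geom_mean_le_tangent {α : ℝ} (hα₀ : 0 < α) (hα₁ : α < 1) {s : ℝ} (hs : 0 < s) {x z : ℝ}
    (hx : 0 ≤ x) (hz : 0 ≤ z) :
    x ^ α * z ^ (1 - α) ≤ α * s * x + (1 - α) * s ^ (α / (α - 1)) * z := by
  have hγ : 0 < s ^ (α / (α - 1)) := Real.rpow_pos_of_pos hs _
  have h := Real.geom_mean_le_arith_mean2_weighted hα₀.le (sub_pos.2 hα₁).le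
    (mul_nonneg hs.le hx) (mul_nonneg hγ.le hz) (by ring)
  have h1 : s ^ α * (s ^ (α / (α - 1))) ^ (1 - α) = 1 := by
    rw [← Real.rpow_mul hs.le, ← Real.rpow_add hs]
    have : α + α / (α - 1) * (1 - α) = 0 := by
      have : α - 1 ≠ 0 := by linarith
      field_simp
      ring
    rw [this, Real.rpow_zero]
  rw [Real.mul_rpow hs.le hx, Real.mul_rpow hγ.le hz] at h
  calc x ^ α * z ^ (1 - α)
      = s ^ α * (s ^ (α / (α - 1))) ^ (1 - α) * (x ^ α * z ^ (1 - α)) := by rw [h1, one_mul]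
    _ = s ^ α * x ^ α * ((s ^ (α / (α - 1))) ^ (1 - α) * z ^ (1 - α)) := by ring
    _ ≤ _ := h
    _ = _ := by ring

/-- The power cone as an intersection of half-spaces. -/
theorem mem_powerCone_iff {α : ℝ} (hα₀ : 0 < α) (hα₁ : α < 1) {x : Fin 3 → ℝ} :
    x ∈ powerCone α ↔
      ∀ s : ℝ, 0 < s → |x 1| ≤ α * s * x 0 + (1 - α) * s ^ (α / (α - 1)) * x 2 := by
  constructor
  · rintro ⟨h0, h2, h1⟩ s hs
    exact h1.trans (geom_mean_le_tangent hα₀ hα₁ hs h0 h2)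
  · intro h
    have hα1 : 0 < 1 - α := by linarith
    have hγ : α / (α - 1) < 0 := div_neg_of_pos_of_neg hα₀ (by linarith)
    have hinf : Filter.Tendsto (fun s : ℝ => s ^ (α / (α - 1))) Filter.atTop (nhds 0) := by
      have := tendsto_rpow_neg_atTop (neg_pos.2 hγ)
      simpa using this
    have lim0 : ∀ y : ℝ, (∀ s : ℝ, 0 < s → y ≤ (1 - α) * s ^ (α / (α - 1)) * x 2) → y ≤ 0 := by
      intro y hy
      have h3 : Filter.Tendsto (fun s : ℝ => (1 - α) * s ^ (α / (α - 1)) * x 2) Filter.atTop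
          (nhds 0) := by
        simpa using (hinf.const_mul (1 - α)).mul_const (x 2)
      exact ge_of_tendsto h3 ((Filter.eventually_gt_atTop 0).mono hy)
    have lim2 : ∀ y : ℝ, (∀ s : ℝ, 0 < s → y ≤ α * s * x 0) → y ≤ 0 := by
      intro y hy
      have h3 : Filter.Tendsto (fun s : ℝ => α * s⁻¹ * x 0) Filter.atTop (nhds 0) := by
        simpa using (tendsto_inv_atTop_zero.const_mul α).mul_const (x 0)
      exact ge_of_tendsto h3 ((Filter.eventually_gt_atTop 0).mono fun s hs => hy _ (inv_pos.2 hs))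
    have h0 : 0 ≤ x 0 := by
      by_contra hneg
      rw [not_le] at hneg
      -- Divide the inequality by s and let s → ∞.
      have : -(α * x 0) ≤ 0 := by
        have h3 : Filter.Tendsto (fun s : ℝ => (1 - α) * (s⁻¹ * s ^ (α / (α - 1))) * x 2)
            Filter.atTop (nhds 0) := by
          simpa using (((tendsto_inv_atTop_zero (𝕜 := ℝ)).mul hinf).const_mul (1 - α)).mul_const (x 2)
        refine ge_of_tendsto h3 ((Filter.eventually_gt_atTop 0).mono fun s hs => ?_)
        have h4 := mul_nonneg (inv_pos.2 hs).le ((abs_nonneg _).trans (h s hs))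
        have h5 : s⁻¹ * (α * s * x 0 + (1 - α) * s ^ (α / (α - 1)) * x 2) =
            α * x 0 + (1 - α) * (s⁻¹ * s ^ (α / (α - 1))) * x 2 := by
          field_simp
        linarith
      nlinarith
    have h2 : 0 ≤ x 2 := by
      by_contra hneg
      rw [not_le] at hneg
      -- Divide the inequality by s ^ γ and let s → 0, with s⁻¹ as the parameter.
      have : -x 2 ≤ 0 := by
        have hp : 1 < 1 - α / (α - 1) := by linarith
        have h3 : Filter.Tendsto (fun s : ℝ => α * (s⁻¹ * (s⁻¹ ^ (-(α / (α - 1))))) * x 0 / (1 - α))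
            Filter.atTop (nhds 0) := by
          have h6 : Filter.Tendsto (fun s : ℝ => s⁻¹ ^ (-(α / (α - 1)))) Filter.atTop (nhds 0) := by
            have := (tendsto_inv_atTop_zero (𝕜 := ℝ)).rpow_const
              (p := -(α / (α - 1))) (Or.inr (neg_pos.2 hγ).le)
            rwa [Real.zero_rpow (neg_pos.2 hγ).ne'] at this
          simpa using ((((tendsto_inv_atTop_zero (𝕜 := ℝ)).mul h6).const_mul α).mul_const
            (x 0)).div_const (1 - α)
        refine ge_of_tendsto h3 ((Filter.eventually_gt_atTop 0).mono fun s hs => ?_)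
        have hs' := inv_pos.2 hs
        have h4 := (abs_nonneg _).trans (h s⁻¹ hs')
        have hq : 0 < s⁻¹ ^ (-(α / (α - 1))) := Real.rpow_pos_of_pos hs' _
        have h5 : s⁻¹ ^ (α / (α - 1)) * s⁻¹ ^ (-(α / (α - 1))) = 1 := by
          rw [← Real.rpow_add hs', add_neg_cancel, Real.rpow_zero]
        rw [le_div_iff₀ hα1]
        have h6 := mul_nonneg h4 hq.le
        have h7 : (α * s⁻¹ * x 0 + (1 - α) * s⁻¹ ^ (α / (α - 1)) * x 2) * s⁻¹ ^ (-(α / (α - 1))) =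
            α * (s⁻¹ * (s⁻¹ ^ (-(α / (α - 1))))) * x 0 +
            (1 - α) * x 2 * (s⁻¹ ^ (α / (α - 1)) * s⁻¹ ^ (-(α / (α - 1)))) := by ring
        rw [h5] at h7
        linarith
      linarith
    refine ⟨h0, h2, ?_⟩
    rcases h0.eq_or_lt with h0' | h0'
    · refine (lim0 _ fun s hs => ?_).trans (by positivity)
      simpa [← h0'] using h s hs
    rcases h2.eq_or_lt with h2' | h2'
    · refine (lim2 _ fun s hs => ?_).trans (by positivity)
      simpa [← h2'] using h s hs
    have hq : 0 < x 2 / x 0 := div_pos h2' h0'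
    -- The case of equality in AM-GM: for this s both weighted terms agree with the geometric mean.
    have h3 := h ((x 2 / x 0) ^ (1 - α)) (Real.rpow_pos_of_pos hq _)
    have h4 : (x 2 / x 0) ^ (1 - α) * x 0 = x 0 ^ α * x 2 ^ (1 - α) := by
      rw [Real.div_rpow h2 h0, div_mul_eq_mul_div, div_eq_iff (Real.rpow_pos_of_pos h0' _).ne',
        mul_right_comm, ← Real.rpow_add h0']
      simp [mul_comm]
    have h5 : ((x 2 / x 0) ^ (1 - α)) ^ (α / (α - 1)) * x 2 = x 0 ^ α * x 2 ^ (1 - α) := by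
      rw [← Real.rpow_mul hq.le]
      have : (1 - α) * (α / (α - 1)) = -α := by
        have : α - 1 ≠ 0 := by linarith
        field_simp
        ring
      rw [this, Real.rpow_neg hq.le, Real.div_rpow h2 h0, inv_div, Real.rpow_sub h2', Real.rpow_one]
      field_simp
    calc |x 1| ≤ _ := h3
      _ = α * ((x 2 / x 0) ^ (1 - α) * x 0) +
          (1 - α) * (((x 2 / x 0) ^ (1 - α)) ^ (α / (α - 1)) * x 2) := by ring
      _ = x 0 ^ α * x 2 ^ (1 - α) := by rw [h4, h5]; ring

theorem isClosed_powerCone {α : ℝ} (hα₀ : 0 < α) (hα₁ : α < 1) : IsClosed (powerCone α) := by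
  have h : powerCone α = ⋂ (s : ℝ) (_ : 0 < s),
      {x : Fin 3 → ℝ | |x 1| ≤ α * s * x 0 + (1 - α) * s ^ (α / (α - 1)) * x 2} := by
    ext x
    simp [mem_powerCone_iff hα₀ hα₁]
  rw [h]
  exact isClosed_iInter fun s => isClosed_iInter fun _ => isClosed_le (by fun_prop) (by fun_prop)

/-- The power cone as a convex cone. -/
theorem exists_convexCone_eq_powerCone {α : ℝ} (hα₀ : 0 < α) (hα₁ : α < 1) :
    ∃ K : ConvexCone ℝ (Fin 3 → ℝ), (K : Set (Fin 3 → ℝ)) = powerCone α := by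
  refine ⟨⟨powerCone α, fun c hc x hx => ?_, fun x hx y hy => ?_⟩, rfl⟩
  · rw [mem_powerCone_iff hα₀ hα₁] at hx ⊢
    intro s hs
    have := mul_le_mul_of_nonneg_left (hx s hs) hc.le
    simp only [Pi.smul_apply, smul_eq_mul, abs_mul, abs_of_pos hc]
    linarith
  · rw [mem_powerCone_iff hα₀ hα₁] at hx hy ⊢
    intro s hs
    have h1 := hx s hs
    have h2 := hy s hs
    have h3 := abs_add_le (x 1) (y 1)
    simp only [Pi.add_apply]
    linarith

/-- The exponent α / (α - 1) is the one for which the scaling preserves x₀ ^ α x₂ ^ (1 - α). -/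
theorem diagonal_mem_powerCone {α : ℝ} (hα₁ : α < 1) {t : ℝ} (ht : 0 < t)
    {x : Fin 3 → ℝ} (hx : x ∈ powerCone α) :
    ![t * x 0, x 1, t ^ (α / (α - 1)) * x 2] ∈ powerCone α := by
  obtain ⟨h0, h2, h1⟩ := hx
  have hq : 0 < t ^ (α / (α - 1)) := Real.rpow_pos_of_pos ht _
  refine ⟨mul_nonneg ht.le h0, mul_nonneg hq.le h2, ?_⟩
  have h3 : t ^ α * (t ^ (α / (α - 1))) ^ (1 - α) = 1 := by
    rw [← Real.rpow_mul ht.le, ← Real.rpow_add ht]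
    have : α + α / (α - 1) * (1 - α) = 0 := by
      have : α - 1 ≠ 0 := by linarith
      field_simp
      ring
    rw [this, Real.rpow_zero]
  simp only [Matrix.cons_val_zero, Matrix.cons_val_one, Matrix.cons_val]
  rw [Real.mul_rpow ht.le h0, Real.mul_rpow hq.le h2]
  calc |x 1| ≤ x 0 ^ α * x 2 ^ (1 - α) := h1
    _ = t ^ α * (t ^ (α / (α - 1))) ^ (1 - α) * (x 0 ^ α * x 2 ^ (1 - α)) := by rw [h3, one_mul]
    _ = _ := by ring

/-- At a boundary point (t, t ^ α, 1) with t large, a polynomial equation of the description can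
hold only if it is trivial on the plane x₂ = 1. The strict inequalities are open conditions, so the
set would also contain points of this plane just outside the cone. -/
theorem not_isSemialgebraic_powerCone {α : ℝ} (hα : Irrational α) :
    ¬ IsSemialgebraic (powerCone α) := by
  rintro ⟨F, hF⟩
  let q : MvPolynomial (Fin 3) ℝ →ₐ[ℝ] MvPolynomial (Fin 2) ℝ :=
    MvPolynomial.aeval ![MvPolynomial.X 0, MvPolynomial.X 1, 1]
  have hq : ∀ (x y : ℝ) f, MvPolynomial.eval ![x, y, 1] f = MvPolynomial.eval ![x, y] (q f) := by
    intro x y f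
    have h2 : (MvPolynomial.aeval ![x, y, 1] : MvPolynomial (Fin 3) ℝ →ₐ[ℝ] ℝ) =
        (MvPolynomial.aeval ![x, y]).comp q :=
      MvPolynomial.algHom_ext fun i => by fin_cases i <;> simp [q]
    exact DFunLike.congr_fun h2 f
  have hev : ∀ᶠ t : ℝ in Filter.atTop, ∀ A ∈ F, ∀ f ∈ A.1, q f ≠ 0 →
      MvPolynomial.eval ![t, t ^ α] (q f) ≠ 0 := by
    refine (Filter.eventually_all_finset F).2 fun A _ =>
      (Filter.eventually_all_finset A.1).2 fun f _ => ?_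
    by_cases hf : q f = 0
    · simp [hf]
    · filter_upwards [eventually_eval_rpow_ne_zero hα hf] with t ht _
      simpa using ht
  obtain ⟨t, ht, ht0⟩ := (hev.and (Filter.eventually_gt_atTop 0)).exists
  have hr : 0 < t ^ α := Real.rpow_pos_of_pos ht0 _
  have hmem : ![t, t ^ α, 1] ∈ powerCone α := by
    refine ⟨ht0.le, zero_le_one, ?_⟩
    simp [abs_of_pos hr]
  rw [hF] at hmem
  obtain ⟨A, hA, hA1, hA2⟩ := hmem
  have hzero : ∀ f ∈ A.1, q f = 0 := by
    intro f hf
    by_contra hne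
    exact ht A hA f hf hne (hq t (t ^ α) f ▸ hA1 f hf)
  have hcont : ∀ g : MvPolynomial (Fin 3) ℝ,
      Continuous fun y : ℝ => MvPolynomial.eval ![t, y, 1] g := fun g =>
    (MvPolynomial.continuous_eval g).comp (by fun_prop)
  have hnear : ∀ᶠ y in nhds (t ^ α), ∀ g ∈ A.2, 0 < MvPolynomial.eval ![t, y, 1] g :=
    (Filter.eventually_all_finset A.2).2 fun g hg =>
      (hcont g).continuousAt.eventually_const_lt (hA2 g hg)
  obtain ⟨y, hy, hyt⟩ := ((hnear.filter_mono nhdsWithin_le_nhds).and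
    (self_mem_nhdsWithin : Set.Ioi (t ^ α) ∈ nhdsWithin (t ^ α) (Set.Ioi (t ^ α)))).exists
  have hy' : ![t, y, 1] ∈ powerCone α := by
    rw [hF]
    refine ⟨A, hA, fun f hf => ?_, hy⟩
    rw [hq, hzero f hf, map_zero]
  have h1 := hy'.2.2
  simp only [Matrix.cons_val_zero, Matrix.cons_val_one, Matrix.cons_val, Real.one_rpow,
    mul_one] at h1
  exact absurd ((le_abs_self y).trans h1) (not_le.2 hyt)

/-! ### A dense multiplicative semigroup -/

/-- The powers of 1 - √2 have the form p - q√2 with natural p and q, tend to zero and alternate in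
sign. A natural multiple of a small power with the sign of y approximates y. -/
theorem exists_nat_sub_mul_sqrt_two_near (y : ℝ) {ε : ℝ} (hε : 0 < ε) :
    ∃ n m : ℕ, |(n - m * √2) - y| < ε := by
  have h2 : √2 * √2 = 2 := Real.mul_self_sqrt (by norm_num)
  have hpow : ∀ k : ℕ, ∃ p q : ℕ, (1 - √2) ^ k = p - q * √2 := by
    intro k
    induction k with
    | zero => exact ⟨1, 0, by simp⟩
    | succ k ih =>
      obtain ⟨p, q, h⟩ := ih
      refine ⟨p + 2 * q, p + q, ?_⟩
      rw [pow_succ, h]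
      push_cast
      linear_combination (q : ℝ) * h2
  have hneg : 1 - √2 < 0 := by linarith [Real.lt_sqrt_of_sq_lt (show (1 : ℝ) ^ 2 < 2 by norm_num)]
  have habs : |1 - √2| < 1 := by
    have h3 : √2 < 2 := by
      rw [Real.sqrt_lt' (by norm_num)]
      norm_num
    rw [abs_lt]
    constructor <;> linarith
  obtain ⟨k, hk⟩ := ((tendsto_pow_atTop_nhds_zero_of_abs_lt_one habs).eventually
    (Metric.ball_mem_nhds 0 hε)).exists_forall_of_atTop
  have hk' : ∀ j ≥ k, |(1 - √2) ^ j| < ε := fun j hj => by simpa using hk j hj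
  obtain ⟨j, hj, hsign⟩ : ∃ j ≥ k, 0 ≤ y / (1 - √2) ^ j := by
    rcases le_total 0 y with hy | hy
    · exact ⟨2 * k, by omega, div_nonneg hy ((even_two_mul k).pow_nonneg _)⟩
    · refine ⟨2 * k + 1, by omega, div_nonneg_of_nonpos hy ?_⟩
      exact Odd.pow_nonpos (odd_two_mul_add_one k) hneg.le
  obtain ⟨p, q, hpq⟩ := hpow j
  have hne : (1 - √2) ^ j ≠ 0 := pow_ne_zero _ hneg.ne
  set δ := (1 - √2) ^ j
  let N := ⌊y / δ⌋₊
  refine ⟨N * p, N * q, ?_⟩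
  have h3 : ((N * p : ℕ) : ℝ) - (N * q : ℕ) * √2 - y = (N - y / δ) * δ := by
    rw [sub_mul, div_mul_cancel₀ _ hne, hpq]
    push_cast
    ring
  have h4 : |(N : ℝ) - y / δ| ≤ 1 := by
    have h5 := Nat.floor_le hsign
    have h6 := Nat.lt_floor_add_one (y / δ)
    rw [abs_le]
    constructor <;> linarith
  rw [h3, abs_mul]
  calc _ ≤ 1 * |δ| := by gcongr
    _ < ε := by rw [one_mul]; exact hk' j hj

/-- The multiplicative semigroup generated by `exp 1` and `exp (-√2)` is dense. -/
theorem mem_closure_exp_semigroup {t : ℝ} (ht : 0 < t) :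
    t ∈ closure {s : ℝ | ∃ n m : ℕ, s = Real.exp 1 ^ n * Real.exp (-√2) ^ m} := by
  have h1 : Real.log t ∈ closure {y : ℝ | ∃ n m : ℕ, y = n - m * √2} := by
    rw [Metric.mem_closure_iff]
    intro ε hε
    obtain ⟨n, m, h⟩ := exists_nat_sub_mul_sqrt_two_near (Real.log t) hε
    exact ⟨_, ⟨n, m, rfl⟩, by rwa [dist_comm, Real.dist_eq]⟩
  have h2 := image_closure_subset_closure_image Real.continuous_exp ⟨_, h1, rfl⟩
  rw [Real.exp_log ht] at h2
  refine closure_mono ?_ h2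
  rintro _ ⟨_, ⟨n, m, rfl⟩, rfl⟩
  refine ⟨n, m, ?_⟩
  rw [← Real.exp_nat_mul, ← Real.exp_nat_mul, ← Real.exp_add]
  congr 1
  ring

/-! ### The stationary process of a consistent word function -/

open MeasureTheory ProbabilityTheory in
/-- Consistent and shift-invariant letter probabilities define a stationary process. -/
theorem isStationaryProcess_of_consistent {M : Type} [Fintype M] [Nonempty M] [MeasurableSpace M]
    [MeasurableSingletonClass M] {p : FreeMonoid M → ℝ} (h0 : ∀ w, 0 ≤ p w) (h1 : p 1 = 1)
    (hl : ∀ w, ∑ u, p (FreeMonoid.of u * w) = p w)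
    (hr : ∀ w, ∑ u, p (w * FreeMonoid.of u) = p w) : IsStationaryProcess p := by
  classical
  -- The law of the next letter given the past `w`; if p w = 0 any law works. The process is then
  -- built from these kernels by the Ionescu-Tulcea theorem.
  have hcond : ∀ w : FreeMonoid M, ∃ μ : Measure M, IsProbabilityMeasure μ ∧
      ∀ u, ENNReal.ofReal (p w) * μ {u} = ENNReal.ofReal (p (w * FreeMonoid.of u)) := by
    intro w
    by_cases hw : p w = 0
    · refine ⟨Measure.dirac (Classical.arbitrary M), inferInstance, fun u => ?_⟩
      have h2 : p (w * FreeMonoid.of u) = 0 :=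
        (Finset.sum_eq_zero_iff_of_nonneg fun u _ => h0 _).1 ((hr w).trans hw) u (Finset.mem_univ u)
      simp [hw, h2]
    · have hpos : 0 < p w := lt_of_le_of_ne (h0 w) (Ne.symm hw)
      let P := PMF.ofFintype (fun u => ENNReal.ofReal (p (w * FreeMonoid.of u) / p w)) (by
        rw [← ENNReal.ofReal_sum_of_nonneg fun u _ => div_nonneg (h0 _) (h0 _), ← Finset.sum_div,
          hr, div_self hw, ENNReal.ofReal_one])
      refine ⟨P.toMeasure, inferInstance, fun u => ?_⟩
      rw [PMF.toMeasure_apply_singleton _ _ (measurableSet_singleton u), PMF.ofFintype_apply,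
        ← ENNReal.ofReal_mul (h0 w), mul_div_cancel₀ _ hw]
  choose μ hμ hμp using hcond
  -- The coordinates 0, …, n form a word of n + 1 letters.
  let word : (n : ℕ) → ((i : Finset.Iic n) → M) → FreeMonoid M := fun n x =>
    FreeMonoid.ofList (List.ofFn fun i : Fin (n + 1) => x ⟨i, Finset.mem_Iic.2 (by omega)⟩)
  let κ : (n : ℕ) → Kernel ((i : Finset.Iic n) → M) M := fun n =>
    ⟨fun x => μ (word n x), measurable_of_countable _⟩
  have : ∀ n, IsMarkovKernel (κ n) := fun n => ⟨fun x => hμ _⟩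
  let P : Measure (ℕ → M) := Kernel.trajMeasure (X := fun _ => M) (μ 1) κ
  have hP : IsProbabilityMeasure P := inferInstance
  have hcyl : ∀ n x, P (Preorder.frestrictLe n ⁻¹' {x}) = ENNReal.ofReal (p (word n x)) := by
    intro n
    induction n with
    | zero =>
      intro x
      have hmap : P.map (Preorder.frestrictLe 0) =
          (μ 1).map (MeasurableEquiv.piUnique fun _ : Finset.Iic 0 => M).symm := by
        simp only [P, Kernel.trajMeasure]
        rw [Measure.map_comp _ _ (by fun_prop), Kernel.traj_map_frestrictLe,
          Kernel.partialTraj_self, Measure.id_comp]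
      rw [← Measure.map_apply (by fun_prop) (measurableSet_singleton x), hmap,
        Measure.map_apply (by fun_prop) (measurableSet_singleton x)]
      have hset : (MeasurableEquiv.piUnique fun _ : Finset.Iic 0 => M).symm ⁻¹' {x} =
          {x ⟨0, by simp⟩} := by
        ext u
        simp only [Set.mem_preimage, Set.mem_singleton_iff]
        rw [← MeasurableEquiv.coe_toEquiv_symm, Equiv.symm_apply_eq]
        rfl
      rw [hset]
      have h2 := hμp 1 (x ⟨0, by simp⟩)
      rw [h1, ENNReal.ofReal_one, one_mul] at h2
      rw [h2]
      rfl
    | succ n ih =>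
      intro x
      let y : (i : Finset.Iic n) → M := fun i =>
        x ⟨i, Finset.mem_Iic.2 ((Finset.mem_Iic.1 i.2).trans n.le_succ)⟩
      let u : M := x ⟨n + 1, by simp⟩
      have hset : Preorder.frestrictLe (π := fun _ => M) (n + 1) ⁻¹' {x} =
          (fun ω : ℕ → M => (Preorder.frestrictLe (π := fun _ => M) n ω, ω (n + 1))) ⁻¹'
            ({y} ×ˢ {u}) := by
        ext ω
        simp only [Set.mem_preimage, Set.mem_singleton_iff, Set.mem_prod]
        constructor
        · rintro rfl
          exact ⟨rfl, rfl⟩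
        · rintro ⟨hy, hu⟩
          ext ⟨i, hi⟩
          rcases (Finset.mem_Iic.1 hi).lt_or_eq with h | rfl
          · exact congrFun hy ⟨i, Finset.mem_Iic.2 (Nat.lt_succ_iff.1 h)⟩
          · exact hu
      rw [hset, ← Measure.map_apply (by fun_prop)
        ((measurableSet_singleton y).prod (measurableSet_singleton u)),
        ← Kernel.map_frestrictLe_trajMeasure_compProd_eq_map_trajMeasure,
        Measure.compProd_apply_prod (measurableSet_singleton y) (measurableSet_singleton u),
        lintegral_singleton, Measure.map_apply (by fun_prop) (measurableSet_singleton y), ih y,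
        mul_comm]
      change _ * μ (word n y) {u} = _
      rw [hμp]
      congr 2
      simp only [word]
      rw [List.ofFn_succ' (n := n + 1), List.concat_eq_append, FreeMonoid.ofList_append]
      rfl
  let E : ℕ → FreeMonoid M → Set (ℕ → M) := fun t w =>
    {ω | ∀ i : Fin w.toList.length, ω (t + i) = w.toList.get i}
  have hmem : ∀ t u w ω, ω ∈ E t (FreeMonoid.of u * w) ↔ ω t = u ∧ ω ∈ E (t + 1) w := by
    intro t u w ω
    change (∀ i : Fin (w.toList.length + 1), ω (t + i) = (u :: w.toList).get i) ↔
      _ ∧ ∀ i : Fin w.toList.length, ω (t + 1 + i) = w.toList.get i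
    rw [Fin.forall_fin_succ]
    simp [add_assoc, add_comm 1]
  have hmeas : ∀ t w, MeasurableSet (E t w) := by
    intro t w
    have : E t w = ⋂ i : Fin w.toList.length, (fun ω : ℕ → M => ω (t + i)) ⁻¹' {w.toList.get i} := by
      ext ω
      simp [E]
    rw [this]
    exact MeasurableSet.iInter fun i => (measurable_pi_apply _) (measurableSet_singleton _)
  refine ⟨ℕ → M, inferInstance, P, fun t ω => ω t, hP, fun t => measurable_pi_apply t, ?_⟩
  change ∀ t w, P.real (E t w) = p w
  intro t
  induction t with
  | zero =>
    intro w
    rcases hw : w.toList.length with _ | n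
    · have hw1 : w = 1 := List.length_eq_zero_iff.1 hw
      subst hw1
      have : E 0 1 = Set.univ := by
        ext ω
        simp only [E, Set.mem_ofPred_eq, Set.mem_univ, iff_true]
        exact fun i => i.elim0
      rw [this, h1]
      simp
    · let x : (i : Finset.Iic n) → M := fun i =>
        w.toList.get ⟨i, by have := Finset.mem_Iic.1 i.2; omega⟩
      have hx : word n x = w := by
        simp only [word, x]
        apply FreeMonoid.toList.injective
        rw [FreeMonoid.toList_ofList]
        apply List.ext_get
        · simp [hw]
        · intro i h1 h2
          rw [List.get_ofFn]
          rfl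
      have hE : E 0 w = Preorder.frestrictLe (π := fun _ => M) n ⁻¹' {x} := by
        ext ω
        simp only [E, Set.mem_ofPred_eq, Set.mem_preimage, Set.mem_singleton_iff, zero_add]
        constructor
        · intro h
          ext ⟨i, hi⟩
          exact h ⟨i, by have := Finset.mem_Iic.1 hi; omega⟩
        · intro h i
          exact congrFun h ⟨i, Finset.mem_Iic.2 (by have := i.2; omega)⟩
      rw [hE, Measure.real, hcyl, hx, ENNReal.toReal_ofReal (h0 w)]
  | succ t ih =>
    intro w
    have hE : E (t + 1) w = ⋃ u ∈ (Finset.univ : Finset M), E t (FreeMonoid.of u * w) := by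
      ext ω
      simp [hmem]
    rw [hE, measureReal_biUnion_finset _ fun u _ => hmeas _ _]
    · simp only [ih, hl]
    · intro u _ v _ huv
      refine Set.disjoint_left.2 fun ω h1 h2 => huv ?_
      rw [← ((hmem _ _ _ _).1 h1).1, ((hmem _ _ _ _).1 h2).1]

/-! ### Positive semidefinite matrices and quantum realizations -/

section PositiveSemidefinite

open scoped ComplexOrder

theorem Matrix.PosSemidef.exists_eq_conjTranspose_mul_self {n : Type*} [Fintype n] [DecidableEq n]
    {A : Matrix n n ℂ} (hA : A.PosSemidef) : ∃ K : Matrix n n ℂ, A = K.conjTranspose * K := by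
  open scoped MatrixOrder in
  exact CStarAlgebra.nonneg_iff_eq_star_mul_self.1 hA.nonneg

theorem Matrix.PosSemidef.trace_mul_nonneg {n : Type*} [Fintype n] [DecidableEq n]
    {A B : Matrix n n ℂ} (hA : A.PosSemidef) (hB : B.PosSemidef) : 0 ≤ (A * B).trace := by
  obtain ⟨K, rfl⟩ := hA.exists_eq_conjTranspose_mul_self
  rw [Matrix.mul_assoc, Matrix.trace_mul_comm]
  exact (hB.mul_mul_conjTranspose_same K).trace_nonneg

open Matrix Unitary in
/-- The support projection of a positive semidefinite matrix. -/
theorem Matrix.PosSemidef.exists_support {n : Type*} [Fintype n] [DecidableEq n]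
    {ρ : Matrix n n ℂ} (hρ : ρ.PosSemidef) :
    ∃ (P : Matrix n n ℂ) (C : ℝ), P.IsHermitian ∧ P * P = P ∧ ρ * P = ρ ∧
      ((C : ℂ) • ρ - P).PosSemidef := by
  let σ := conjStarAlgAut ℂ _ hρ.1.eigenvectorUnitary
  have hσ : ρ = σ (diagonal (RCLike.ofReal ∘ hρ.1.eigenvalues)) := hρ.1.spectral_theorem
  let e := hρ.1.eigenvalues
  have he : ∀ i, 0 ≤ e i := hρ.eigenvalues_nonneg
  let χ : n → ℂ := fun i => if e i = 0 then 0 else 1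
  -- This dominates the inverse of each nonzero eigenvalue; zero eigenvalues contribute 0⁻¹ = 0.
  let C : ℝ := ∑ i, (e i)⁻¹
  refine ⟨σ (diagonal χ), C, ?_, ?_, ?_, ?_⟩
  · rw [Matrix.IsHermitian, ← Matrix.star_eq_conjTranspose, ← map_star,
      Matrix.star_eq_conjTranspose, diagonal_conjTranspose]
    congr 2
    ext i
    simp [χ, apply_ite]
  · rw [← map_mul, diagonal_mul_diagonal]
    congr 2
    ext i
    simp [χ]
  · conv_lhs => rw [hσ]
    conv_rhs => rw [hσ]
    rw [← map_mul, diagonal_mul_diagonal]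
    congr 2
    ext i
    by_cases h : e i = 0 <;> simp [χ, h, e]
  · conv in (_ • ρ) => rw [hσ]
    rw [← map_smul, ← map_sub]
    have h1 : (C : ℂ) • diagonal (RCLike.ofReal ∘ e) - diagonal χ =
        (diagonal (fun i => ((C * e i - if e i = 0 then 0 else 1 : ℝ) : ℂ)) : Matrix n n ℂ) := by
      ext i j
      by_cases hij : i = j
      · subst hij
        simp [χ, apply_ite]
        tauto
      · simp [hij]
    change (σ ((C : ℂ) • diagonal (RCLike.ofReal ∘ e) - diagonal χ)).PosSemidef
    rw [h1]
    simp only [σ, conjStarAlgAut_apply]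
    rw [Matrix.star_eq_conjTranspose]
    refine PosSemidef.mul_mul_conjTranspose_same (PosSemidef.diagonal fun i => ?_) _
    rw [Pi.zero_apply, Complex.zero_le_real]
    by_cases h : e i = 0
    · simp [h]
    · have hpos : 0 < e i := lt_of_le_of_ne (he i) (Ne.symm h)
      have hle : (e i)⁻¹ ≤ C :=
        Finset.single_le_sum (f := fun i => (e i)⁻¹) (fun j _ => inv_nonneg.2 (he j))
          (Finset.mem_univ i)
      have := mul_le_mul_of_nonneg_right hle hpos.le
      rw [inv_mul_cancel₀ h] at this
      simpa [h] using this

open Matrix in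
/-- A positive semidefinite matrix below `ρ` is supported on any `P` with `ρ P = ρ`. -/
theorem Matrix.PosSemidef.mul_eq_self_of_le {n : Type*} [Fintype n] [DecidableEq n]
    {ρ B P : Matrix n n ℂ} (hρP : ρ * P = ρ) (hB : B.PosSemidef)
    (hBρ : (ρ - B).PosSemidef) : B * P = B := by
  obtain ⟨K, rfl⟩ := hB.exists_eq_conjTranspose_mul_self
  have h1 : 0 ≤ ((1 - P)ᴴ * (ρ - Kᴴ * K) * (1 - P)).trace :=
    (hBρ.conjTranspose_mul_mul_same _).trace_nonneg
  have h2 : 0 ≤ ((1 - P)ᴴ * (Kᴴ * K) * (1 - P)).trace :=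
    (hB.conjTranspose_mul_mul_same _).trace_nonneg
  have h3 : (1 - P)ᴴ * (ρ - Kᴴ * K) * (1 - P) = - ((1 - P)ᴴ * (Kᴴ * K) * (1 - P)) := by
    have h4 : ρ * (1 - P) = 0 := by rw [mul_sub, mul_one, hρP, sub_self]
    rw [mul_assoc, sub_mul, h4, zero_sub, mul_neg, ← mul_assoc]
  rw [h3, trace_neg, neg_nonneg] at h1
  have h4 := le_antisymm h1 h2
  have h5 : (1 - P)ᴴ * (Kᴴ * K) * (1 - P) = (K * (1 - P))ᴴ * (K * (1 - P)) := by
    rw [conjTranspose_mul]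
    simp only [mul_assoc]
  rw [h5, trace_conjTranspose_mul_self_eq_zero_iff] at h4
  rw [mul_sub, mul_one, sub_eq_zero] at h4
  rw [mul_assoc, ← h4]

open Matrix in
/-- A positive functional on matrices is represented by a positive semidefinite matrix. -/
theorem exists_posSemidef_trace_mul_eq {d : ℕ} (f : Matrix (Fin d) (Fin d) ℂ →ₗ[ℂ] ℂ)
    (hreal : ∀ X : selfAdjoint (Matrix (Fin d) (Fin d) ℂ),
      star (f (X : Matrix (Fin d) (Fin d) ℂ)) = f (X : Matrix (Fin d) (Fin d) ℂ))
    (hpos : ∀ X : Matrix (Fin d) (Fin d) ℂ, X.PosSemidef → 0 ≤ f X) :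
    ∃ B : Matrix (Fin d) (Fin d) ℂ, B.PosSemidef ∧ ∀ X, (X * B).trace = f X := by
  have hstar : ∀ X : Matrix (Fin d) (Fin d) ℂ, f (star X) = star (f X) := by
    intro X
    have h1 := realPart_add_I_smul_imaginaryPart X
    conv_lhs => rw [← h1]
    conv_rhs => rw [← h1]
    rw [star_add, star_smul, selfAdjoint.star_val_eq, selfAdjoint.star_val_eq, map_add, map_add,
      map_smul, map_smul, star_add, hreal, star_smul, hreal]
  let B : Matrix (Fin d) (Fin d) ℂ := .of fun i j => f (Matrix.single j i 1)
  have hB : ∀ X, (X * B).trace = f X := by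
    intro X
    conv_rhs => rw [matrix_eq_sum_single X]
    rw [Matrix.trace_mul_eq_sum]
    simp only [map_sum]
    refine Finset.sum_congr rfl fun i _ => Finset.sum_congr rfl fun j _ => ?_
    have : Matrix.single i j (X i j) = X i j • Matrix.single i j (1 : ℂ) := by
      rw [smul_single, smul_eq_mul, mul_one]
    rw [this, map_smul]
    rfl
  refine ⟨B, .of_dotProduct_mulVec_nonneg ?_ fun z => ?_, hB⟩
  · ext i j
    simp only [B, conjTranspose_apply, of_apply]
    rw [← hstar, star_eq_conjTranspose, conjTranspose_single, star_one]
  · have h1 := hpos _ (posSemidef_vecMulVec_self_star z)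
    rw [← hB, Matrix.vecMulVec_mul, Matrix.trace_vecMulVec, dotProduct_comm] at h1
    rwa [dotProduct_mulVec]

open scoped Matrix.Norms.L2Operator MatrixOrder in
open Matrix in
/-- A quantum realization factors the Hankel matrix `p (v * w)` through bounded positive
semidefinite matrices. -/
theorem HasQuantumRealization.exists_psd_factorization {M : Type} [Fintype M] [MeasurableSpace M]
    {p : FreeMonoid M → ℝ} (h : HasQuantumRealization p) :
    ∃ (d : ℕ) (C : ℝ) (A B : FreeMonoid M → Matrix (Fin d) (Fin d) ℂ),
      (∀ w, (A w).PosSemidef) ∧ (∀ v, (B v).PosSemidef) ∧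
      (∀ v w, (A w * B v).trace = (p (v * w) : ℂ)) ∧
      (∀ w, (A w).trace.re ≤ C * p w) ∧ ∀ v, (B v).trace.re ≤ p v := by
  classical
  obtain ⟨d, S, ρ, E, ⟨-, hp⟩, hρ, -, hπ, hD, hτ⟩ := h
  let 𝓔 : FreeMonoid M →* Module.End ℂ (Matrix (Fin d) (Fin d) ℂ) :=
    FreeMonoid.lift fun u => (E u).toLinearMap
  have h𝓔of : ∀ u X, 𝓔 (FreeMonoid.of u) X = E u X := fun u X => by
    simp only [𝓔, FreeMonoid.lift_eval_of]
    rfl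
  have h𝓔 : ∀ w (X : selfAdjoint (Matrix (Fin d) (Fin d) ℂ)),
      (S.D w X : Matrix (Fin d) (Fin d) ℂ) = 𝓔 w X := by
    intro w
    induction w using FreeMonoid.inductionOn' with
    | one => intro X; simp
    | of_mul u w ih =>
      intro X
      rw [map_mul, map_mul, Module.End.mul_apply, Module.End.mul_apply, hD, ih, h𝓔of]
  have h𝓔pos : ∀ w (X : Matrix (Fin d) (Fin d) ℂ), X.PosSemidef → (𝓔 w X).PosSemidef := by
    intro w
    induction w using FreeMonoid.inductionOn' with
    | one => intro X hX; simpa using hX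
    | of_mul u w ih =>
      intro X hX
      rw [map_mul, Module.End.mul_apply, h𝓔of]
      exact (map_nonneg (E u) (ih X hX).nonneg).posSemidef
  let f : FreeMonoid M → Matrix (Fin d) (Fin d) ℂ →ₗ[ℂ] ℂ := fun v =>
    (Matrix.traceLinearMap (Fin d) ℂ ℂ) ∘ₗ (LinearMap.mulLeft ℂ ρ) ∘ₗ 𝓔 v
  have hf : ∀ v X, f v X = (ρ * 𝓔 v X).trace := fun v X => rfl
  have hfS : ∀ v (X : selfAdjoint (Matrix (Fin d) (Fin d) ℂ)),
      f v (X : Matrix (Fin d) (Fin d) ℂ) = (S.π (S.D v X) : ℂ) := by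
    intro v X
    rw [hf, hπ, h𝓔]
  have hfpos : ∀ v X, X.PosSemidef → 0 ≤ f v X := fun v X hX =>
    hρ.trace_mul_nonneg (h𝓔pos v X hX)
  -- Prefixing a letter selects one of the nonnegative terms whose sum is unchanged, by the
  -- invariance of π.
  have hfle : ∀ v X, X.PosSemidef → f v X ≤ f 1 X := by
    intro v
    induction v using FreeMonoid.inductionOn' with
    | one => intro X _; exact le_rfl
    | of_mul u v ih =>
      intro X hX
      refine le_trans ?_ (ih X hX)
      have h1 : ∀ u', f (FreeMonoid.of u' * v) X = f (FreeMonoid.of u') (𝓔 v X) := by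
        intro u'
        rw [hf, hf, map_mul, Module.End.mul_apply]
      have h2 : ∑ u', f (FreeMonoid.of u') (𝓔 v X) = f v X := by
        let Y : selfAdjoint (Matrix (Fin d) (Fin d) ℂ) := ⟨X, hX.1⟩
        have h3 := DFunLike.congr_fun S.π_fixed (S.D v Y)
        rw [LinearMap.comp_apply, LinearMap.sum_apply, map_sum] at h3
        have h4 : ∀ u', f (FreeMonoid.of u') (𝓔 v X) =
            (S.π (S.D (FreeMonoid.of u') (S.D v Y)) : ℂ) := by
          intro u'
          rw [← hfS, h𝓔]
        simp only [h4]
        rw [← Complex.ofReal_sum, h3, ← hfS]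
      rw [h1, ← h2]
      exact Finset.single_le_sum (f := fun u' => f (FreeMonoid.of u') (𝓔 v X))
        (fun u' _ => hfpos _ _ (h𝓔pos v X hX)) (Finset.mem_univ u)
  have hB := fun v => exists_posSemidef_trace_mul_eq (f v)
    (fun X => by rw [hfS]; exact Complex.conj_ofReal _) (hfpos v)
  choose B hB hBf using hB
  have hBρ : ∀ v, (ρ - B v).PosSemidef := by
    intro v
    obtain ⟨B', hB', hB'f⟩ := exists_posSemidef_trace_mul_eq (f 1 - f v)
      (fun X => by
        rw [LinearMap.sub_apply, hfS, hfS, ← Complex.ofReal_sub]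
        exact Complex.conj_ofReal _)
      (fun X hX => by
        rw [LinearMap.sub_apply, sub_nonneg]
        exact hfle v X hX)
    have : ρ - B v = B' := by
      apply (Matrix.ext_iff_trace_mul_left).2
      intro X
      rw [mul_sub, trace_sub, hBf, hB'f, LinearMap.sub_apply, hf 1, map_one, Module.End.one_apply,
        trace_mul_comm]
    rw [this]
    exact hB'
  -- The state ρ does not control `𝓔 w 1` off its support. Compression by `P` does not change traces
  -- against `B v ≤ ρ`, and `P ≤ C ρ` then bounds the trace by `C * p w`.
  obtain ⟨P, C, hP, hPP, hρP, hC⟩ := hρ.exists_support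
  have hBP : ∀ v, B v * P = B v := fun v => (hB v).mul_eq_self_of_le hρP (hBρ v)
  have hPB : ∀ v, P * B v = B v := fun v => by
    have := congrArg conjTranspose (hBP v)
    rwa [conjTranspose_mul, hP.eq, (hB v).1.eq] at this
  have hA : ∀ w, (𝓔 w 1).PosSemidef := fun w => h𝓔pos w 1 PosSemidef.one
  have hp1 : ∀ v, f v 1 = p v := fun v => by
    rw [hp, ← hτ, hfS]
    rfl
  refine ⟨d, C, fun w => P * 𝓔 w 1 * Pᴴ, B, fun w => (hA w).mul_mul_conjTranspose_same P, hB,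
    fun v w => ?_, fun w => ?_, fun v => ?_⟩
  · rw [hP.eq, mul_assoc, hPB, trace_mul_comm, ← mul_assoc, hBP, trace_mul_comm, hBf, ← hp1, hf, hf,
      map_mul, Module.End.mul_apply]
  · have h1 := (hA w).trace_mul_nonneg hC
    have h2 : (P * 𝓔 w 1 * Pᴴ).trace = (𝓔 w 1 * P).trace := by
      rw [hP.eq, trace_mul_comm, ← mul_assoc, hPP, trace_mul_comm]
    rw [mul_sub, trace_sub, mul_smul_comm, trace_smul, trace_mul_comm _ ρ, ← hf, hp1, ← h2,
      sub_nonneg] at h1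
    have h3 := (Complex.le_def.1 h1).1
    simpa using h3
  · have h1 := hBf v 1
    rw [one_mul, hp1] at h1
    rw [h1, Complex.ofReal_re]

open Matrix Filter Topology in
/-- Positive semidefinite solutions of linear constraints with continuous right hand sides extend
from a dense set of parameters. -/
theorem exists_gram_of_mem_closure {d : ℕ} {ι : Type*} {T : Set ℝ} {t : ℝ} (ht : t ∈ closure T)
    (A : ℝ → Matrix (Fin d) (Fin d) ℂ) (hA : ∀ s ∈ T, (A s).PosSemidef) (b : ℝ → ℝ)
    (hb : ContinuousAt b t) (htr : ∀ s ∈ T, (A s).trace.re ≤ b s)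
    (X : ι → Matrix (Fin d) (Fin d) ℂ) (f : ι → ℝ → ℂ) (hf : ∀ i, ContinuousAt (f i) t)
    (hX : ∀ s ∈ T, ∀ i, (A s * X i).trace = f i s) :
    ∃ G : Matrix (Fin d) (Fin d) ℂ, (Gᴴ * G).trace.re ≤ b t ∧
      ∀ i, (Gᴴ * G * X i).trace = f i t := by
  obtain ⟨s, hsT, hs⟩ := mem_closure_iff_seq_limit.1 ht
  have hG : ∀ n, ∃ G : Matrix (Fin d) (Fin d) ℂ, A (s n) = Gᴴ * G := fun n =>
    (hA _ (hsT n)).exists_eq_conjTranspose_mul_self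
  choose G hG using hG
  have hbs : Tendsto (fun n => b (s n)) atTop (𝓝 (b t)) := hb.tendsto.comp hs
  obtain ⟨K, hK⟩ := hbs.bddAbove_range
  have hK' : ∀ n, b (s n) ≤ K := fun n => hK ⟨n, rfl⟩
  have hnorm : ∀ n i j, ‖G n i j‖ ^ 2 ≤ K := by
    intro n i j
    have h1 : ((G n)ᴴ * G n).trace.re = ∑ j, ∑ i, ‖G n i j‖ ^ 2 := by
      simp only [trace, diag_apply, Matrix.mul_apply, conjTranspose_apply, Complex.re_sum]
      refine Finset.sum_congr rfl fun j _ => Finset.sum_congr rfl fun i _ => ?_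
      rw [RCLike.star_def, ← Complex.normSq_eq_conj_mul_self, Complex.ofReal_re,
        Complex.normSq_eq_norm_sq]
    have h2 := (htr _ (hsT n)).trans (hK' n)
    rw [hG, h1] at h2
    refine le_trans ?_ h2
    refine le_trans ?_ (Finset.single_le_sum (f := fun j => ∑ i, ‖G n i j‖ ^ 2)
      (fun j _ => by positivity) (Finset.mem_univ j))
    exact Finset.single_le_sum (f := fun i => ‖G n i j‖ ^ 2) (fun j _ => by positivity)
      (Finset.mem_univ i)
  have hcomp : IsCompact (Set.pi Set.univ fun _ : Fin d => Set.pi Set.univ fun _ : Fin d =>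
      Metric.closedBall (0 : ℂ) (√K)) :=
    isCompact_univ_pi fun _ => isCompact_univ_pi fun _ => isCompact_closedBall _ _
  have hseq : ∀ g : ℕ → Fin d → Fin d → ℂ, (∀ n i j, ‖g n i j‖ ≤ √K) →
      ∃ (G₀ : Fin d → Fin d → ℂ) (φ : ℕ → ℕ), StrictMono φ ∧ Tendsto (g ∘ φ) atTop (𝓝 G₀) := by
    intro g hg
    obtain ⟨G₀, -, φ, hφ, hlim⟩ := hcomp.tendsto_subseq (x := g) fun n i _ j _ => by
      rw [mem_closedBall_zero_iff]
      exact hg n i j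
    exact ⟨G₀, φ, hφ, hlim⟩
  obtain ⟨G₀, φ, hφ, hlim⟩ : ∃ (G₀ : Matrix (Fin d) (Fin d) ℂ) (φ : ℕ → ℕ), StrictMono φ ∧
      Tendsto (fun n => G (φ n)) atTop (𝓝 G₀) :=
    hseq G fun n i j => Real.le_sqrt_of_sq_le (hnorm n i j)
  have hsφ : Tendsto (fun n => s (φ n)) atTop (𝓝 t) := hs.comp hφ.tendsto_atTop
  have hc : Continuous fun G : Matrix (Fin d) (Fin d) ℂ => Gᴴ * G :=
    continuous_id.matrix_conjTranspose.matrix_mul continuous_id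
  have hlimA : Tendsto (fun n => A (s (φ n))) atTop (𝓝 (G₀ᴴ * G₀)) := by
    simp only [hG]
    exact (hc.tendsto _).comp hlim
  refine ⟨G₀, ?_, fun i => ?_⟩
  · have h1 : Tendsto (fun n => (A (s (φ n))).trace.re) atTop (𝓝 (G₀ᴴ * G₀).trace.re) :=
      ((Complex.continuous_re.comp continuous_id.matrix_trace).tendsto _).comp hlimA
    exact le_of_tendsto_of_tendsto' h1 (hb.tendsto.comp hsφ) fun n => htr _ (hsT _)
  · have h1 : Tendsto (fun n => (A (s (φ n)) * X i).trace) atTop (𝓝 (G₀ᴴ * G₀ * X i).trace) :=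
      ((continuous_id.matrix_mul continuous_const).matrix_trace.tendsto _).comp hlimA
    exact tendsto_nhds_unique h1
      (((hf i).tendsto.comp hsφ).congr fun n => (hX _ (hsT _) i).symm)

/-! ### Stable cones, regularity and quantum realizations -/

/-- A quasi-realization on `ℝ ^ 3` whose letter maps are, up to positive factors, a rank one map
between boundary rays of the power cone and its dual, two diagonal automorphisms generating a dense
semigroup, and a reflection. -/
structure IsPowerRealization (α : ℝ) (R : QuasiRealization (Fin 4) (Fin 3 → ℝ)) (ν σ : ℝ) :
    Prop where
  ν_pos : 0 < ν
  σ_pos : 0 < σ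
  D0 : ∀ x, R.D (FreeMonoid.of 0) x = (σ * (α * x 0 + x 1 + (1 - α) * x 2)) • ![1, 1, 1]
  D1 : ∀ x, R.D (FreeMonoid.of 1) x =
    ν • ![Real.exp 1 * x 0, x 1, Real.exp 1 ^ (α / (α - 1)) * x 2]
  D2 : ∀ x, R.D (FreeMonoid.of 2) x =
    ν • ![Real.exp (-√2) * x 0, x 1, Real.exp (-√2) ^ (α / (α - 1)) * x 2]
  D3 : ∀ x, R.D (FreeMonoid.of 3) x = ν • ![x 0, -x 1, x 2]
  τ_mem : R.τ ∈ powerCone α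
  τ_pos : 0 < α * R.τ 0 + R.τ 1 + (1 - α) * R.τ 2
  π_nonneg : ∀ x ∈ powerCone α, 0 ≤ R.π x
  π_pos : 0 < R.π ![1, 1, 1]
  π_τ : R.π R.τ = 1

namespace IsPowerRealization

variable {α ν σ : ℝ} {R : QuasiRealization (Fin 4) (Fin 3 → ℝ)}

open FreeMonoid (of)

theorem D1_pow (h : IsPowerRealization α R ν σ) (n : ℕ) (x : Fin 3 → ℝ) :
    R.D (of 1 ^ n) x =
      ν ^ n • ![Real.exp 1 ^ n * x 0, x 1, (Real.exp 1 ^ n) ^ (α / (α - 1)) * x 2] := by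
  induction n with
  | zero =>
    ext i
    fin_cases i <;> simp
  | succ n ih =>
    rw [pow_succ', map_mul, Module.End.mul_apply, ih, h.D1, pow_succ' (Real.exp 1),
      Real.mul_rpow (Real.exp_pos _).le (by positivity)]
    ext i
    fin_cases i <;> simp <;> ring

theorem D2_pow (h : IsPowerRealization α R ν σ) (n : ℕ) (x : Fin 3 → ℝ) :
    R.D (of 2 ^ n) x =
      ν ^ n • ![Real.exp (-√2) ^ n * x 0, x 1, (Real.exp (-√2) ^ n) ^ (α / (α - 1)) * x 2] := by
  induction n with
  | zero =>
    ext i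
    fin_cases i <;> simp
  | succ n ih =>
    rw [pow_succ', map_mul, Module.End.mul_apply, ih, h.D2, pow_succ' (Real.exp (-√2)),
      Real.mul_rpow (Real.exp_pos _).le (by positivity)]
    ext i
    fin_cases i <;> simp <;> ring

theorem D_diagonal (h : IsPowerRealization α R ν σ) (n m : ℕ) (x : Fin 3 → ℝ) :
    R.D (of 1 ^ n * of 2 ^ m) x = ν ^ (n + m) • ![Real.exp 1 ^ n * Real.exp (-√2) ^ m * x 0, x 1,
      (Real.exp 1 ^ n * Real.exp (-√2) ^ m) ^ (α / (α - 1)) * x 2] := by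
  rw [map_mul, Module.End.mul_apply, h.D2_pow, h.D1_pow,
    Real.mul_rpow (by positivity) (by positivity)]
  ext i
  fin_cases i <;> simp <;> ring

theorem D0_τ (h : IsPowerRealization α R ν σ) :
    ∃ c : ℝ, 0 < c ∧ R.D (of 0) R.τ = c • ![1, 1, 1] :=
  ⟨_, mul_pos h.σ_pos h.τ_pos, h.D0 _⟩

theorem π_D0 (h : IsPowerRealization α R ν σ) :
    ∃ c : ℝ, 0 < c ∧ ∀ x, R.π (R.D (of 0) x) = c * (α * x 0 + x 1 + (1 - α) * x 2) := by
  refine ⟨σ * R.π ![1, 1, 1], mul_pos h.σ_pos h.π_pos, fun x => ?_⟩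
  rw [h.D0, map_smul, smul_eq_mul]
  ring

theorem map_mem_powerCone (h : IsPowerRealization α R ν σ) (hα₀ : 0 < α) (hα₁ : α < 1)
    (w : FreeMonoid (Fin 4)) : ∀ x ∈ powerCone α, R.D w x ∈ powerCone α := by
  obtain ⟨K, hK⟩ := exists_convexCone_eq_powerCone hα₀ hα₁
  have hsmul : ∀ c : ℝ, 0 ≤ c → ∀ x ∈ powerCone α, c • x ∈ powerCone α := by
    intro c hc x hx
    rcases hc.eq_or_lt with rfl | hc
    · rw [zero_smul]
      refine ⟨le_rfl, le_rfl, ?_⟩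
      simp [Real.zero_rpow hα₀.ne']
    · rw [← hK] at hx ⊢
      exact K.smul_mem hc hx
  induction w using FreeMonoid.inductionOn' with
  | one => intro x hx; simpa using hx
  | of_mul u w ih =>
    intro x hx
    rw [map_mul, Module.End.mul_apply]
    have hy := ih x hx
    generalize R.D w x = y at hy
    fin_cases u
    · refine h.D0 y ▸ hsmul _ (mul_nonneg h.σ_pos.le ?_) _ ?_
      · have h1 := (mem_powerCone_iff hα₀ hα₁).1 hy 1 one_pos
        rw [Real.one_rpow, mul_one, mul_one] at h1
        linarith [neg_abs_le (y 1)]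
      · exact ⟨by simp, by simp, by simp⟩
    · exact h.D1 y ▸ hsmul _ h.ν_pos.le _ (diagonal_mem_powerCone hα₁ (Real.exp_pos _) hy)
    · exact h.D2 y ▸ hsmul _ h.ν_pos.le _ (diagonal_mem_powerCone hα₁ (Real.exp_pos _) hy)
    · refine h.D3 y ▸ hsmul _ h.ν_pos.le _ ⟨hy.1, hy.2.1, ?_⟩
      simpa using hy.2.2

theorem isStableCone_powerCone (h : IsPowerRealization α R ν σ) (hα₀ : 0 < α) (hα₁ : α < 1) :
    R.IsStableCone (powerCone α) :=
  ⟨exists_convexCone_eq_powerCone hα₀ hα₁, h.τ_mem, h.map_mem_powerCone hα₀ hα₁, h.π_nonneg⟩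

theorem realizes (h : IsPowerRealization α R ν σ) (hα₀ : 0 < α) (hα₁ : α < 1) :
    R.Realizes R.wordProb := by
  refine ⟨isStationaryProcess_of_consistent (fun w => ?_) ?_ (fun w => ?_) fun w => ?_,
    fun w => rfl⟩
  · exact h.π_nonneg _ (h.map_mem_powerCone hα₀ hα₁ w _ h.τ_mem)
  · simp [QuasiRealization.wordProb, h.π_τ]
  · have h1 := DFunLike.congr_fun R.π_fixed (R.D w R.τ)
    rw [LinearMap.comp_apply, LinearMap.sum_apply, map_sum] at h1
    simpa [QuasiRealization.wordProb] using h1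
  · have h1 := congrArg (fun x => R.π (R.D w x)) R.τ_fixed
    simp only [LinearMap.sum_apply, map_sum] at h1
    simpa [QuasiRealization.wordProb] using h1

/-- A stable cone is contained in the power cone. -/
theorem subset_powerCone (h : IsPowerRealization α R ν σ) (hα₀ : 0 < α) (hα₁ : α < 1)
    {C : Set (Fin 3 → ℝ)} (hC : R.IsStableCone C) : C ⊆ powerCone α := by
  obtain ⟨c, hc, hπ⟩ := h.π_D0
  -- Positivity of π after D₀ and a diagonal word is the tangent inequality for a parameter in the
  -- dense semigroup. Applied also to the image of x under D₃, it bounds |x₁|.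
  have key : ∀ x ∈ C, ∀ t : ℝ, 0 < t →
      0 ≤ α * (t * x 0) + x 1 + (1 - α) * (t ^ (α / (α - 1)) * x 2) := by
    intro x hx t ht
    have hcont : ContinuousAt
        (fun t : ℝ => α * (t * x 0) + x 1 + (1 - α) * (t ^ (α / (α - 1)) * x 2)) t := by
      have := Real.continuousAt_rpow_const t (α / (α - 1)) (Or.inl ht.ne')
      fun_prop
    obtain ⟨s, hs, hlim⟩ := mem_closure_iff_seq_limit.1 (mem_closure_exp_semigroup ht)
    refine ge_of_tendsto' (hcont.tendsto.comp hlim) fun k => ?_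
    obtain ⟨n, m, hnm⟩ := hs k
    have h1 := hC.π_nonneg _ (hC.map_mem (of 0 * (of 1 ^ n * of 2 ^ m)) x hx)
    rw [map_mul, Module.End.mul_apply, hπ, h.D_diagonal, ← hnm] at h1
    have h2 : (0 : ℝ) < c * ν ^ (n + m) := mul_pos hc (pow_pos h.ν_pos _)
    refine (mul_nonneg_iff_of_pos_left h2).1 (h1.trans_eq ?_)
    simp
    ring
  intro x hx
  rw [mem_powerCone_iff hα₀ hα₁]
  intro s hs
  have h1 := key x hx s hs
  have h2 := key _ (hC.map_mem (of 3) x hx) s hs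
  rw [h.D3] at h2
  simp only [Pi.smul_apply, smul_eq_mul, Matrix.cons_val_zero, Matrix.cons_val_one,
    Matrix.cons_val] at h2
  have h3 : 0 ≤ α * (s * x 0) - x 1 + (1 - α) * (s ^ (α / (α - 1)) * x 2) := by
    refine (mul_nonneg_iff_of_pos_left h.ν_pos).1 (h2.trans_eq ?_)
    ring
  rw [abs_le]
  constructor <;> linarith

/-- A closed stable cone contains the power cone. -/
theorem powerCone_subset (h : IsPowerRealization α R ν σ) (hα₀ : 0 < α) (hα₁ : α < 1)
    {C : Set (Fin 3 → ℝ)} (hcl : IsClosed C) (hC : R.IsStableCone C) : powerCone α ⊆ C := by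
  obtain ⟨c, hc, hτ⟩ := h.D0_τ
  obtain ⟨K, rfl⟩ := hC.isConvexCone
  have hscale : ∀ (c : ℝ) (x : Fin 3 → ℝ), 0 < c → c • x ∈ K → x ∈ K := by
    intro c x hc hx
    have := K.smul_mem (inv_pos.2 hc) hx
    rwa [smul_smul, inv_mul_cancel₀ hc.ne', one_smul] at this
  have hray : ∀ (ε : ℝ), (∀ n m : ℕ, ![Real.exp 1 ^ n * Real.exp (-√2) ^ m, ε,
      (Real.exp 1 ^ n * Real.exp (-√2) ^ m) ^ (α / (α - 1))] ∈ K) → ∀ t : ℝ, 0 < t →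
      ![t, ε, t ^ (α / (α - 1))] ∈ K := by
    intro ε hε t ht
    have hcont : ContinuousAt (fun t : ℝ => ![t, ε, t ^ (α / (α - 1))]) t := by
      have := Real.continuousAt_rpow_const t (α / (α - 1)) (Or.inl ht.ne')
      rw [continuousAt_pi]
      intro i
      fin_cases i
      · exact continuousAt_id
      · exact continuousAt_const
      · exact this
    obtain ⟨s, hs, hlim⟩ := mem_closure_iff_seq_limit.1 (mem_closure_exp_semigroup ht)
    refine hcl.mem_of_tendsto (hcont.tendsto.comp hlim) (Filter.Eventually.of_forall fun k => ?_)
    obtain ⟨n, m, hnm⟩ := hs k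
    simp only [Function.comp_apply, hnm]
    exact hε n m
  have hpos : ∀ n m : ℕ, ![Real.exp 1 ^ n * Real.exp (-√2) ^ m, 1,
      (Real.exp 1 ^ n * Real.exp (-√2) ^ m) ^ (α / (α - 1))] ∈ K := by
    intro n m
    have h1 := hC.map_mem (of 1 ^ n * of 2 ^ m) _ (hC.map_mem (of 0) _ hC.τ_mem)
    rw [hτ, map_smul, h.D_diagonal] at h1
    have h2 := hscale _ _ (pow_pos h.ν_pos _) (hscale _ _ hc h1)
    simpa using h2
  have hneg : ∀ n m : ℕ, ![Real.exp 1 ^ n * Real.exp (-√2) ^ m, -1,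
      (Real.exp 1 ^ n * Real.exp (-√2) ^ m) ^ (α / (α - 1))] ∈ K := by
    intro n m
    have h1 := hC.map_mem (of 3) _ (hpos n m)
    rw [h.D3] at h1
    have h2 := hscale _ _ h.ν_pos h1
    simpa using h2
  have hint : ∀ x ∈ powerCone α, 0 < x 0 → 0 < x 2 → x ∈ K := by
    intro x hx h0 h2
    have hg : 0 < x 0 ^ α * x 2 ^ (1 - α) :=
      mul_pos (Real.rpow_pos_of_pos h0 _) (Real.rpow_pos_of_pos h2 _)
    set g := x 0 ^ α * x 2 ^ (1 - α) with hgdef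
    -- With this parameter, g times the two boundary rays gives (x₀, ±g, x₂), and x lies on the
    -- segment between these points.
    have ht : 0 < x 0 / g := div_pos h0 hg
    have htγ : (x 0 / g) ^ (α / (α - 1)) = x 2 / g := by
      have hα : α - 1 ≠ 0 := by linarith
      have h3 : x 0 / g = (x 2 / x 0) ^ (α - 1) := by
        rw [div_eq_iff hg.ne', hgdef, Real.div_rpow h2.le h0.le, div_mul_eq_mul_div,
          eq_div_iff (Real.rpow_pos_of_pos h0 _).ne']
        have h4 : x 2 ^ (α - 1) * x 2 ^ (1 - α) = 1 := by
          rw [← Real.rpow_add h2]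
          simp
        have h5 : x 0 ^ α = x 0 * x 0 ^ (α - 1) := by
          rw [Real.rpow_sub h0, Real.rpow_one]
          field_simp
        rw [h5]
        linear_combination (-(x 0 * x 0 ^ (α - 1))) * h4
      have h6 : x 2 / g = (x 2 / x 0) ^ α := by
        rw [div_eq_iff hg.ne', hgdef, Real.div_rpow h2.le h0.le, div_mul_eq_mul_div,
          eq_div_iff (Real.rpow_pos_of_pos h0 _).ne']
        have h4 : x 2 ^ α * x 2 ^ (1 - α) = x 2 := by
          rw [← Real.rpow_add h2]
          simp
        linear_combination (-(x 0 ^ α)) * h4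
      rw [h3, h6, ← Real.rpow_mul (div_pos h2 h0).le, mul_div_cancel₀ _ hα]
    have hp := K.smul_mem hg (hray 1 hpos _ ht)
    have hm := K.smul_mem hg (hray (-1) hneg _ ht)
    rw [htγ] at hp hm
    have habs := abs_le.1 hx.2.2
    rw [← hgdef] at habs
    have hcomb := K.convex hp hm (a := (1 + x 1 / g) / 2) (b := (1 - x 1 / g) / 2)
      (by
        have : -1 ≤ x 1 / g := by
          rw [le_div_iff₀ hg]
          linarith
        linarith)
      (by
        have : x 1 / g ≤ 1 := by
          rw [div_le_iff₀ hg]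
          linarith
        linarith)
      (by ring)
    convert! hcomb using 1
    ext i
    fin_cases i <;> simp <;> field_simp <;> ring
  intro x hx
  have hlim : Filter.Tendsto (fun ε : ℝ => x + ε • ![1, 0, 1]) (nhdsWithin 0 (Set.Ioi 0))
      (nhds x) := by
    have h1 : Continuous fun ε : ℝ => x + ε • ![(1 : ℝ), 0, 1] := by fun_prop
    have h2 := h1.tendsto 0
    rw [zero_smul, add_zero] at h2
    exact h2.mono_left nhdsWithin_le_nhds
  refine hcl.mem_of_tendsto hlim ?_
  filter_upwards [self_mem_nhdsWithin] with ε hε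
  have hε' : 0 < ε := hε
  obtain ⟨K', hK'⟩ := exists_convexCone_eq_powerCone hα₀ hα₁
  refine hint _ ?_ ?_ ?_
  · have h1 : ![(1 : ℝ), 0, 1] ∈ powerCone α := ⟨by simp, by simp, by simp⟩
    rw [← hK'] at hx h1 ⊢
    exact K'.add_mem hx (K'.smul_mem hε' h1)
  · simpa using add_pos_of_nonneg_of_pos hx.1 hε'
  · simpa using add_pos_of_nonneg_of_pos hx.2.1 hε'

theorem isClosed_isStableCone_iff (h : IsPowerRealization α R ν σ) (hα₀ : 0 < α) (hα₁ : α < 1)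
    (C : Set (Fin 3 → ℝ)) : IsClosed C ∧ R.IsStableCone C ↔ C = powerCone α := by
  constructor
  · rintro ⟨hcl, hC⟩
    exact (h.subset_powerCone hα₀ hα₁ hC).antisymm (h.powerCone_subset hα₀ hα₁ hcl hC)
  · rintro rfl
    exact ⟨isClosed_powerCone hα₀ hα₁, h.isStableCone_powerCone hα₀ hα₁⟩

/-- The Hankel matrix has rank 3: the orbit vectors of the words 0, 30 and 10 are independent in
`R`, and the functionals of 0, 03 and 01 separate the points of ℝ³. A linear relation among the
orbit vectors in any other realization would therefore carry over to `R`. -/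
theorem isRegular (h : IsPowerRealization α R ν σ) (hα₀ : 0 < α) (hα₁ : α < 1) :
    R.IsRegular := by
  intro W _ _ S hS
  obtain ⟨c, hc, hτ⟩ := h.D0_τ
  obtain ⟨c', hc', hπ⟩ := h.π_D0
  have he1 : (1 : ℝ) < Real.exp 1 := Real.one_lt_exp_iff.2 one_pos
  have heγ : Real.exp 1 ^ (α / (α - 1)) < 1 :=
    Real.rpow_lt_one_of_one_lt_of_neg he1 (div_neg_of_pos_of_neg hα₀ (by linarith))
  have hν := h.ν_pos
  let v : Fin 3 → FreeMonoid (Fin 4) := ![of 0, of 3 * of 0, of 1 * of 0]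
  have hli : LinearIndependent ℝ fun i => S.D (v i) S.τ := by
    rw [Fintype.linearIndependent_iff]
    intro g hg
    have hobs : ∀ w, R.π (R.D w (∑ i, g i • R.D (v i) R.τ)) = 0 := by
      intro w
      have h1 : S.π (S.D w (∑ i, g i • S.D (v i) S.τ)) = 0 := by rw [hg, map_zero, map_zero]
      rw [← h1]
      simp only [map_sum, map_smul]
      refine Finset.sum_congr rfl fun i _ => ?_
      have h2 := congrFun hS (w * v i)
      simp only [QuasiRealization.wordProb, map_mul, Module.End.mul_apply] at h2
      rw [h2]
    set y := ∑ i, g i • R.D (v i) R.τ with hy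
    have hform : ∀ w, α * R.D w y 0 + R.D w y 1 + (1 - α) * R.D w y 2 = 0 := by
      intro w
      have h1 := hobs (of 0 * w)
      rw [map_mul, Module.End.mul_apply, hπ] at h1
      exact (mul_eq_zero.1 h1).resolve_left hc'.ne'
    have f1 := hform 1
    have f2 := hform (of 3)
    have f3 := hform (of 1)
    rw [map_one, Module.End.one_apply] at f1
    rw [h.D3] at f2
    rw [h.D1] at f3
    simp only [Pi.smul_apply, smul_eq_mul, Matrix.cons_val_zero, Matrix.cons_val_one,
      Matrix.cons_val] at f2 f3
    replace f2 : α * y 0 - y 1 + (1 - α) * y 2 = 0 := by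
      refine (mul_eq_zero.1 (?_ : ν * _ = 0)).resolve_left hν.ne'
      linarith
    replace f3 : α * (Real.exp 1 * y 0) + y 1 +
        (1 - α) * (Real.exp 1 ^ (α / (α - 1)) * y 2) = 0 := by
      refine (mul_eq_zero.1 (?_ : ν * _ = 0)).resolve_left hν.ne'
      linarith
    have y1 : y 1 = 0 := by linarith
    have y0 : y 0 = 0 := by
      refine (mul_eq_zero.1 (?_ : (α * (Real.exp 1 - Real.exp 1 ^ (α / (α - 1)))) * y 0 = 0)).resolve_left
        (mul_pos hα₀ (by linarith)).ne'
      linear_combination f3 - Real.exp 1 ^ (α / (α - 1)) * f1 +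
        (Real.exp 1 ^ (α / (α - 1)) - 1) * y1
    have y2 : y 2 = 0 := by
      refine (mul_eq_zero.1 (?_ : (1 - α) * y 2 = 0)).resolve_left (by linarith)
      linear_combination f1 - α * y0 - y1
    rw [Fin.sum_univ_three] at hy
    simp only [v, Matrix.cons_val_zero, Matrix.cons_val_one, Matrix.cons_val, map_mul,
      Module.End.mul_apply, hτ, h.D3, h.D1] at hy
    have z0 := congrFun hy 0
    have z1 := congrFun hy 1
    have z2 := congrFun hy 2
    simp only [Pi.add_apply, Pi.smul_apply, smul_eq_mul, Matrix.cons_val_zero,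
      Matrix.cons_val_one, Matrix.cons_val, y0, y1, y2] at z0 z1 z2
    have hcν : 0 < c * ν := mul_pos hc hν
    have g2 : g 2 = 0 := by
      refine (mul_eq_zero.1 (?_ : (c * ν * (Real.exp 1 - Real.exp 1 ^ (α / (α - 1)))) * g 2
        = 0)).resolve_left (mul_pos hcν (by linarith)).ne'
      linear_combination z2 - z0
    have g1 : g 1 = 0 := by
      refine (mul_eq_zero.1 (?_ : (2 * (c * ν)) * g 1 = 0)).resolve_left (by positivity)
      linear_combination z1 - z0 - (c * ν * Real.exp 1 - c * ν) * g2
    have g0 : g 0 = 0 := by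
      refine (mul_eq_zero.1 (?_ : c * g 0 = 0)).resolve_left hc.ne'
      linear_combination -z1 + (c * ν) * g1 - (c * ν) * g2
    intro i
    fin_cases i
    · exact g0
    · exact g1
    · exact g2
  have := hli.cardinal_le_rank
  simpa using this

theorem not_hasQuantumRealization (h : IsPowerRealization α R ν σ) (hα₀ : 0 < α) (hα₁ : α < 1)
    (hirr : Irrational α) : ¬ HasQuantumRealization R.wordProb := by
  intro hq
  obtain ⟨d, C, A, B, hA, hB, hAB, hAtr, hBtr⟩ := hq.exists_psd_factorization
  obtain ⟨c, hc, hτ⟩ := h.D0_τ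
  obtain ⟨c', hc', hπ⟩ := h.π_D0
  have hν := h.ν_pos
  let T : Set ℝ := {s : ℝ | ∃ n m : ℕ, s = Real.exp 1 ^ n * Real.exp (-√2) ^ m}
  have hT : ∀ s, s ∈ T → ∃ n m : ℕ, s = Real.exp 1 ^ n * Real.exp (-√2) ^ m := fun s hs => hs
  choose! N M hNM using hT
  have hTpos : ∀ s ∈ T, 0 < s := fun s hs => by
    rw [hNM s hs]
    positivity
  let a : ℝ → ℝ := fun s => c * ν ^ (N s + M s)
  let b : ℝ → ℝ := fun s => c' * (ν * ν ^ (N s + M s))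
  have ha : ∀ s, 0 < a s := fun s => by positivity
  have hb : ∀ s, 0 < b s := fun s => by positivity
  let w : ℝ → FreeMonoid (Fin 4) := fun s => (of 1 ^ N s * of 2 ^ M s) * of 0
  -- The reflection makes the functional (α s, -1, (1 - α) s ^ γ), which vanishes on the ray (t, 1,
  -- t ^ γ) when t s = 1.
  let v : ℝ → FreeMonoid (Fin 4) := fun s => of 0 * (of 3 * (of 1 ^ N s * of 2 ^ M s))
  have hw : ∀ s ∈ T, R.D (w s) R.τ = a s • ![s, 1, s ^ (α / (α - 1))] := by
    intro s hs
    simp only [w, a]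
    rw [map_mul, Module.End.mul_apply, hτ, map_smul, h.D_diagonal, ← hNM s hs, smul_smul]
    simp
  have hv : ∀ s ∈ T, ∀ x, R.π (R.D (v s) x) =
      b s * (α * (s * x 0) - x 1 + (1 - α) * (s ^ (α / (α - 1)) * x 2)) := by
    intro s hs x
    simp only [v, b]
    rw [map_mul, Module.End.mul_apply, hπ, map_mul, Module.End.mul_apply, h.D3, h.D_diagonal,
      ← hNM s hs]
    simp
    ring
  let A' : ℝ → Matrix (Fin d) (Fin d) ℂ := fun s => (((a s)⁻¹ : ℝ) : ℂ) • A (w s)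
  let B' : ℝ → Matrix (Fin d) (Fin d) ℂ := fun s => (((b s)⁻¹ : ℝ) : ℂ) • B (v s)
  let f : ℝ → ℝ → ℂ := fun s t =>
    ((α * (t * s) - 1 + (1 - α) * (t * s) ^ (α / (α - 1)) : ℝ) : ℂ)
  have hA' : ∀ s ∈ T, (A' s).PosSemidef := fun s _ =>
    (hA _).smul (Complex.zero_le_real.2 (inv_pos.2 (ha s)).le)
  have hB' : ∀ s ∈ T, (B' s).PosSemidef := fun s _ =>
    (hB _).smul (Complex.zero_le_real.2 (inv_pos.2 (hb s)).le)
  have hA'B' : ∀ t ∈ T, ∀ s ∈ T, (A' t * B' s).trace = f s t := by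
    intro t ht s hs
    simp only [A', B', f]
    rw [smul_mul_smul_comm, Matrix.trace_smul, hAB, QuasiRealization.wordProb, map_mul,
      Module.End.mul_apply, hw t ht, map_smul, map_smul, hv s hs,
      Real.mul_rpow (hTpos t ht).le (hTpos s hs).le, smul_eq_mul, smul_eq_mul,
      ← Complex.ofReal_mul, ← Complex.ofReal_mul]
    congr 1
    have h1 := (ha t).ne'
    have h2 := (hb s).ne'
    simp only [Matrix.cons_val_zero, Matrix.cons_val_one, Matrix.cons_val]
    field_simp
  have hA'tr : ∀ s ∈ T, (A' s).trace.re ≤ C * R.π ![s, 1, s ^ (α / (α - 1))] := by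
    intro s hs
    have h1 := hAtr (w s)
    rw [QuasiRealization.wordProb, hw s hs, map_smul, smul_eq_mul] at h1
    simp only [A']
    rw [Matrix.trace_smul, smul_eq_mul, Complex.re_ofReal_mul, inv_mul_le_iff₀ (ha s)]
    linarith
  have hB'tr : ∀ s ∈ T, (B' s).trace.re ≤
      α * (s * R.τ 0) - R.τ 1 + (1 - α) * (s ^ (α / (α - 1)) * R.τ 2) := by
    intro s hs
    have h1 := hBtr (v s)
    rw [QuasiRealization.wordProb, hv s hs] at h1
    simp only [B']
    rwa [Matrix.trace_smul, smul_eq_mul, Complex.re_ofReal_mul, inv_mul_le_iff₀ (hb s)]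
  have hfcont : ∀ s t : ℝ, 0 < s → 0 < t → ContinuousAt (f s) t := by
    intro s t hs ht
    have h1 : ContinuousAt (fun t : ℝ => (t * s) ^ (α / (α - 1))) t :=
      ContinuousAt.rpow_const (by fun_prop) (Or.inl (mul_pos ht hs).ne')
    exact Complex.continuous_ofReal.continuousAt.comp (by fun_prop)
  -- Compactness is used twice: t is extended to all positive reals against s in `T`, and then s is
  -- extended against all the new factors `G t`.
  have hG : ∀ t : ℝ, 0 < t → ∃ G : Matrix (Fin d) (Fin d) ℂ,
      ∀ s : T, (G.conjTranspose * G * B' s).trace = f s t := by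
    intro t ht
    have hcont : ContinuousAt (fun t : ℝ => C * R.π ![t, 1, t ^ (α / (α - 1))]) t := by
      refine continuousAt_const.mul
        (R.π.continuous_of_finiteDimensional.continuousAt.comp (continuousAt_pi.2 fun i => ?_))
      fin_cases i
      · exact continuousAt_id
      · exact continuousAt_const
      · exact Real.continuousAt_rpow_const t (α / (α - 1)) (Or.inl ht.ne')
    obtain ⟨G, -, hG⟩ := exists_gram_of_mem_closure (mem_closure_exp_semigroup ht) A' hA' _ hcont
      hA'tr (fun s : T => B' s) (fun s : T => f s) (fun s => hfcont s t (hTpos s s.2) ht)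
      (fun t ht s => hA'B' t ht s s.2)
    exact ⟨G, hG⟩
  choose! G hG using hG
  have hH : ∀ s : ℝ, 0 < s → ∃ H : Matrix (Fin d) (Fin d) ℂ, ∀ t : Set.Ioi (0 : ℝ),
      (H.conjTranspose * H * ((G t).conjTranspose * G t)).trace = f t s := by
    intro s hs
    have hcont : ContinuousAt (fun s : ℝ =>
        α * (s * R.τ 0) - R.τ 1 + (1 - α) * (s ^ (α / (α - 1)) * R.τ 2)) s := by
      have := Real.continuousAt_rpow_const s (α / (α - 1)) (Or.inl hs.ne')
      fun_prop
    obtain ⟨H, -, hH⟩ := exists_gram_of_mem_closure (mem_closure_exp_semigroup hs) B' hB' _ hcont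
      hB'tr (fun t : Set.Ioi (0 : ℝ) => (G t).conjTranspose * G t) (fun t => f t)
      (fun t => hfcont t s t.2 hs)
      (fun s hs t => by
        rw [Matrix.trace_mul_comm, hG t t.2 ⟨s, hs⟩]
        simp only [f, mul_comm])
    exact ⟨H, hH⟩
  choose! H hH using hH
  have hγ : Irrational (α / (α - 1)) := by
    have h1 : α / (α - 1) = 1 - (1 - α)⁻¹ := by
      have h2 : α - 1 ≠ 0 := by linarith
      have h3 : 1 - α ≠ 0 := by linarith
      field_simp
      ring
    rw [h1]
    simpa using ((hirr.ratCast_sub 1).inv).ratCast_sub 1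
  refine not_exists_gram_factorization hα₀.ne' hγ G H fun t s ht hs => ?_
  rw [Matrix.trace_mul_comm, hH s hs ⟨t, ht⟩]
  simp only [f, mul_comm s t]

end IsPowerRealization

end PositiveSemidefinite

/-! ### The explicit realization -/

/-- The scaling of the rank one map is chosen so that the unnormalized sum
`q⁻¹ • m μᵀ + diag (L₀, 1, L₂)` has the eigenvalue `L₀ + L₂` with positive eigenvectors. -/
theorem exists_isPowerRealization {α : ℝ} (hα₀ : 0 < α) (hα₁ : α < 1) :
    ∃ (ν s σ : ℝ) (R : QuasiRealization (Fin 4) (Fin 3 → ℝ)),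
      0 < s ∧ 0 < ν ∧ IsPowerRealization α R ν σ ∧
      (∀ u, R.D (FreeMonoid.of u) = Matrix.toLin' (powerMaps α ν (Real.exp 1) (Real.exp (-√2))
        ![1, 1, 1] ![s * α, s, s * (1 - α)] u)) ∧
      Module.End.eigenspace R.total 1 = Submodule.span ℝ {R.τ} ∧
      Module.End.eigenspace R.total.dualMap 1 = Submodule.span ℝ {R.π} := by
  set a := Real.exp 1 with ha
  set b := Real.exp (-√2) with hb
  have ha0 : 0 < a := Real.exp_pos _
  have hb0 : 0 < b := Real.exp_pos _
  set c := a ^ (α / (α - 1)) with hc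
  set e := b ^ (α / (α - 1)) with he
  have hc0 : 0 < c := Real.rpow_pos_of_pos ha0 _
  have he0 : 0 < e := Real.rpow_pos_of_pos hb0 _
  obtain ⟨L₀, hL₀⟩ : ∃ L₀, L₀ = a + b + 1 := ⟨_, rfl⟩
  obtain ⟨L₂, hL₂⟩ : ∃ L₂, L₂ = c + e + 1 := ⟨_, rfl⟩
  have hL₀1 : 1 < L₀ := by linarith
  have hL₂1 : 1 < L₂ := by linarith
  -- With l = L₀ + L₂, the entries of l - diag(L₀, 1, L₂) are L₂, L₁, L₀. Their inverses give τ and,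
  -- weighted by α, 1, 1 - α, the direction of π. Below, q is the value of (α, 1, 1 - α) on τ, and k
  -- normalizes π(τ) to 1.
  obtain ⟨L₁, hL₁⟩ : ∃ L₁, L₁ = L₀ + L₂ - 1 := ⟨_, rfl⟩
  have hL₁1 : 1 < L₁ := by linarith
  have hL₀0 : 0 < L₀ := by linarith
  have hL₁0 : 0 < L₁ := by linarith
  have hL₂0 : 0 < L₂ := by linarith
  have hα1 : 0 < 1 - α := by linarith
  obtain ⟨q, hq⟩ : ∃ q, q = α / L₂ + 1 / L₁ + (1 - α) / L₀ := ⟨_, rfl⟩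
  have hq0 : 0 < q := by rw [hq]; positivity
  obtain ⟨l, hl⟩ : ∃ l, l = L₀ + L₂ := ⟨_, rfl⟩
  have hl0 : 0 < l := by linarith
  obtain ⟨k, hk⟩ : ∃ k, k = α / L₂ / L₂ + 1 / L₁ / L₁ + (1 - α) / L₀ / L₀ := ⟨_, rfl⟩
  have hk0 : 0 < k := by rw [hk]; positivity
  let Dm := powerMaps α l⁻¹ a b ![1, 1, 1] ![q⁻¹ * α, q⁻¹, q⁻¹ * (1 - α)]
  let D : FreeMonoid (Fin 4) →* Module.End ℝ (Fin 3 → ℝ) :=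
    FreeMonoid.lift fun u => Matrix.toLin' (Dm u)
  have hD : ∀ u, D (FreeMonoid.of u) = Matrix.toLin' (Dm u) := fun u => FreeMonoid.lift_eval_of _ _
  have hD0 : ∀ x, D (FreeMonoid.of 0) x =
      (l⁻¹ * q⁻¹ * (α * x 0 + x 1 + (1 - α) * x 2)) • ![1, 1, 1] := by
    intro x
    rw [hD, Matrix.toLin'_apply]
    ext i
    fin_cases i <;>
      simp [Dm, powerMaps, Matrix.mulVec, dotProduct, Fin.sum_univ_three] <;> ring
  have hdiag : ∀ (d : Fin 3 → ℝ) (x : Fin 3 → ℝ), Matrix.toLin' (l⁻¹ • Matrix.diagonal d) x =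
      l⁻¹ • ![d 0 * x 0, d 1 * x 1, d 2 * x 2] := by
    intro d x
    rw [Matrix.toLin'_apply, Matrix.smul_mulVec]
    congr 1
    ext i
    rw [Matrix.mulVec_diagonal]
    fin_cases i <;> rfl
  have hD1 : ∀ x, D (FreeMonoid.of 1) x = l⁻¹ • ![a * x 0, x 1, c * x 2] := by
    intro x
    rw [hD]
    refine (hdiag ![a, 1, c] x).trans ?_
    simp
  have hD2 : ∀ x, D (FreeMonoid.of 2) x = l⁻¹ • ![b * x 0, x 1, e * x 2] := by
    intro x
    rw [hD]
    refine (hdiag ![b, 1, e] x).trans ?_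
    simp
  have hD3 : ∀ x, D (FreeMonoid.of 3) x = l⁻¹ • ![x 0, -x 1, x 2] := by
    intro x
    rw [hD]
    refine (hdiag ![1, -1, 1] x).trans ?_
    simp
  have htot : ∀ x, (∑ u, D (FreeMonoid.of u)) x =
      l⁻¹ • ((q⁻¹ * (α * x 0 + x 1 + (1 - α) * x 2)) • ![1, 1, 1] +
        ![L₀ * x 0, x 1, L₂ * x 2]) := by
    intro x
    rw [LinearMap.sum_apply, Fin.sum_univ_four, hD0, hD1, hD2, hD3, hL₀, hL₂]
    ext i
    fin_cases i <;> simp <;> ring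
  let τ : Fin 3 → ℝ := ![1 / L₂, 1 / L₁, 1 / L₀]
  let φ : ℝ → Module.Dual ℝ (Fin 3 → ℝ) := fun r =>
    (r * (α / L₂)) • LinearMap.proj 0 + (r * (1 / L₁)) • LinearMap.proj 1 +
      (r * ((1 - α) / L₀)) • LinearMap.proj 2
  have hφ : ∀ r x, φ r x = r * (α / L₂ * x 0 + 1 / L₁ * x 1 + (1 - α) / L₀ * x 2) := by
    intro r x
    simp [φ]
    ring
  have hSτ : α * τ 0 + τ 1 + (1 - α) * τ 2 = q := by
    simp only [τ, hq, Matrix.cons_val_zero, Matrix.cons_val_one, Matrix.cons_val]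
    ring
  have hφone : ∀ r, φ r ![1, 1, 1] = r * q := by
    intro r
    rw [hφ, hq]
    simp
  have hφdiag : ∀ r x, φ r ![L₀ * x 0, x 1, L₂ * x 2] =
      l * φ r x - r * (α * x 0 + x 1 + (1 - α) * x 2) := by
    intro r x
    rw [hφ, hφ]
    simp only [Matrix.cons_val_zero, Matrix.cons_val_one, Matrix.cons_val]
    field_simp
    rw [hl, hL₁]
    ring
  have hπfix : ∀ r x, φ r ((∑ u, D (FreeMonoid.of u)) x) = φ r x := by
    intro r x
    rw [htot, map_smul, map_add, map_smul, hφone, hφdiag]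
    simp only [smul_eq_mul]
    field_simp
    ring
  have hτfix : (∑ u, D (FreeMonoid.of u)) τ = τ := by
    rw [htot, hSτ, inv_mul_cancel₀ hq0.ne', one_smul, inv_smul_eq_iff₀ hl0.ne']
    ext i
    fin_cases i <;> simp [τ] <;> field_simp <;> linarith
  let R : QuasiRealization (Fin 4) (Fin 3 → ℝ) :=
    { π := φ k⁻¹
      D := D
      τ := τ
      π_fixed := LinearMap.ext fun x => hπfix _ x
      τ_fixed := hτfix }
  have hRtot : R.total = ∑ u, D (FreeMonoid.of u) := rfl
  refine ⟨l⁻¹, q⁻¹, l⁻¹ * q⁻¹, R, inv_pos.2 hq0, inv_pos.2 hl0,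
    ⟨inv_pos.2 hl0, by positivity, hD0, hD1, hD2, hD3, ?_, ?_, ?_, ?_, ?_⟩, hD, ?_, ?_⟩
  · rw [mem_powerCone_iff hα₀ hα₁]
    intro s hs
    have h1 := geom_mean_le_tangent hα₀ hα₁ hs zero_le_one zero_le_one
    simp only [Real.one_rpow, mul_one] at h1
    have hsγ : 0 < s ^ (α / (α - 1)) := Real.rpow_pos_of_pos hs _
    change |1 / L₁| ≤ α * s * (1 / L₂) + (1 - α) * s ^ (α / (α - 1)) * (1 / L₀)
    rw [abs_of_pos (by positivity)]
    calc 1 / L₁ = 1 * (1 / L₁) := (one_mul _).symm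
      _ ≤ (α * s + (1 - α) * s ^ (α / (α - 1))) * (1 / L₁) := by gcongr
      _ = α * s * (1 / L₁) + (1 - α) * s ^ (α / (α - 1)) * (1 / L₁) := by ring
      -- Here L₁ exceeds both L₀ and L₂, because each of these is greater than 1.
      _ ≤ _ := by
        gcongr <;> linarith
  · exact hSτ ▸ hq0
  · intro x hx
    have h1 := (mem_powerCone_iff hα₀ hα₁).1 hx 1 one_pos
    rw [Real.one_rpow, mul_one, mul_one] at h1
    have h2 := neg_abs_le (x 1)
    have hx0 := hx.1
    have hx2 := hx.2.1
    change 0 ≤ φ k⁻¹ x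
    rw [hφ]
    refine mul_nonneg (inv_pos.2 hk0).le ?_
    have h3 : 0 ≤ 1 / L₁ * (α * x 0 + x 1 + (1 - α) * x 2) := by
      refine mul_nonneg (by positivity) (by linarith)
    have h4 : 1 / L₁ * (α * x 0) ≤ 1 / L₂ * (α * x 0) := by
      gcongr
      linarith
    have h5 : 1 / L₁ * ((1 - α) * x 2) ≤ 1 / L₀ * ((1 - α) * x 2) := by
      gcongr
      linarith
    calc 0 ≤ _ := h3
      _ = 1 / L₁ * (α * x 0) + 1 / L₁ * x 1 + 1 / L₁ * ((1 - α) * x 2) := by ring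
      _ ≤ 1 / L₂ * (α * x 0) + 1 / L₁ * x 1 + 1 / L₀ * ((1 - α) * x 2) := by gcongr
      _ = _ := by ring
  · change 0 < φ k⁻¹ _
    rw [hφone]
    positivity
  · change φ k⁻¹ τ = 1
    rw [hφ, inv_mul_eq_one₀ hk0.ne', hk]
    simp [τ]
    ring
  · ext x
    rw [Module.End.mem_eigenspace_iff, one_smul, Submodule.mem_span_singleton]
    constructor
    · intro hx
      rw [hRtot, htot, inv_smul_eq_iff₀ hl0.ne'] at hx
      set r := q⁻¹ * (α * x 0 + x 1 + (1 - α) * x 2)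
      have h0 := congrFun hx 0
      have h1 := congrFun hx 1
      have h2 := congrFun hx 2
      simp only [Pi.add_apply, Pi.smul_apply, smul_eq_mul, Matrix.cons_val_zero,
        Matrix.cons_val_one, Matrix.cons_val, mul_one] at h0 h1 h2
      refine ⟨r, ?_⟩
      change r • τ = x
      ext i
      fin_cases i <;> simp [τ] <;> rw [← div_eq_mul_inv, div_eq_iff (by positivity)]
      · rw [hl] at h0
        linarith
      · rw [hl] at h1
        rw [hL₁]
        linarith
      · rw [hl] at h2
        linarith
    · rintro ⟨r, rfl⟩
      rw [map_smul, hRtot]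
      exact congrArg _ hτfix
  · ext ψ
    rw [Module.End.mem_eigenspace_iff, one_smul, Submodule.mem_span_singleton]
    constructor
    · intro hψ
      have hfix : ∀ x, ψ ((∑ u, D (FreeMonoid.of u)) x) = ψ x := fun x =>
        DFunLike.congr_fun hψ x
      have hexp : ∀ x, ψ x = x 0 * ψ ![1, 0, 0] + x 1 * ψ ![0, 1, 0] + x 2 * ψ ![0, 0, 1] := by
        intro x
        have : x = x 0 • ![1, 0, 0] + x 1 • ![0, 1, 0] + x 2 • ![0, 0, 1] := by
          ext i
          fin_cases i <;> simp
        conv_lhs => rw [this]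
        simp only [map_add, map_smul, smul_eq_mul]
      obtain ⟨r, hr⟩ : ∃ r, r = q⁻¹ * ψ ![1, 1, 1] := ⟨_, rfl⟩
      have hfix' : ∀ x, (α * x 0 + x 1 + (1 - α) * x 2) * r + ψ ![L₀ * x 0, x 1, L₂ * x 2] =
          l * ψ x := by
        intro x
        have h1 := hfix x
        rw [htot, map_smul, map_add, map_smul, smul_eq_mul, smul_eq_mul,
          inv_mul_eq_iff_eq_mul₀ hl0.ne'] at h1
        rw [← h1, hr]
        ring
      have h0 := hfix' ![1, 0, 0]
      have h1 := hfix' ![0, 1, 0]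
      have h2 := hfix' ![0, 0, 1]
      rw [hexp ![_, _, _]] at h0 h1 h2
      simp only [Matrix.cons_val_zero, Matrix.cons_val_one, Matrix.cons_val, mul_one, mul_zero,
        zero_mul, add_zero, zero_add, one_mul] at h0 h1 h2
      refine ⟨r * k, LinearMap.ext fun x => ?_⟩
      rw [LinearMap.smul_apply, smul_eq_mul]
      change r * k * φ k⁻¹ x = ψ x
      rw [hφ, hexp]
      have e0 : ψ ![1, 0, 0] = r * (α / L₂) := by
        rw [mul_div_assoc', eq_div_iff hL₂0.ne']
        rw [hl] at h0
        linarith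
      have e1 : ψ ![0, 1, 0] = r * (1 / L₁) := by
        rw [mul_div_assoc', eq_div_iff hL₁0.ne', hL₁]
        rw [hl] at h1
        linarith
      have e2 : ψ ![0, 0, 1] = r * ((1 - α) / L₀) := by
        rw [mul_div_assoc', eq_div_iff hL₀0.ne']
        rw [hl] at h2
        linarith
      rw [e0, e1, e2, mul_assoc, ← mul_assoc k, mul_inv_cancel₀ hk0.ne']
      ring
    · rintro ⟨r, rfl⟩
      rw [map_smul]
      congr 1
      exact LinearMap.ext fun x => hπfix _ x

theorem theorem4 (α : ℝ) (hα₀ : 0 < α) (hα₁ : α < 1) :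
    ∃ (ν a b : ℝ) (m₀ μ₀ : Fin 3 → ℝ),
      0 < a ∧ 0 < b ∧ (powerMaps α ν a b m₀ μ₀ 0).rank = 1 ∧
      ∃ R : QuasiRealization (Fin 4) (Fin 3 → ℝ),
        (∀ u, R.D (FreeMonoid.of u) = Matrix.toLin' (powerMaps α ν a b m₀ μ₀ u)) ∧
        -- `τ` and `π` are the unique right and left eigenvectors of `D̄` with eigenvalue `1`
        R.τ ≠ 0 ∧ R.π ≠ 0 ∧
        Module.End.eigenspace R.total 1 = Submodule.span ℝ {R.τ} ∧
        Module.End.eigenspace R.total.dualMap 1 = Submodule.span ℝ {R.π} ∧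
        (∃ p : FreeMonoid (Fin 4) → ℝ, R.Realizes p ∧ R.IsRegular ∧
          (∀ C : Set (Fin 3 → ℝ), IsClosed C ∧ R.IsStableCone C ↔ C = powerCone α) ∧
          (Irrational α → ¬ IsSemialgebraic (powerCone α) ∧ ¬ HasQuantumRealization p)) := by
  obtain ⟨ν, s, σ, R, hs, hν, h, hD, hτ, hπ⟩ := exists_isPowerRealization hα₀ hα₁
  refine ⟨ν, Real.exp 1, Real.exp (-√2), ![1, 1, 1], ![s * α, s, s * (1 - α)], Real.exp_pos _,
    Real.exp_pos _, ?_, R, hD, ?_, ?_, hτ, hπ, R.wordProb, h.realizes hα₀ hα₁,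
    h.isRegular hα₀ hα₁, h.isClosed_isStableCone_iff hα₀ hα₁, fun hirr =>
      ⟨not_isSemialgebraic_powerCone hirr, h.not_hasQuantumRealization hα₀ hα₁ hirr⟩⟩
  · apply le_antisymm
    · change (ν • Matrix.vecMulVec ![1, 1, 1] ![s * α, s, s * (1 - α)]).rank ≤ 1
      rw [← Matrix.smul_vecMulVec]
      exact Matrix.rank_vecMulVec_le _ _
    · rw [Nat.one_le_iff_ne_zero, Matrix.rank]
      intro h0
      rw [Submodule.finrank_eq_zero, LinearMap.range_eq_bot] at h0
      have h1 := congrFun (LinearMap.congr_fun h0 ![0, 1, 0]) 0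
      simp [powerMaps, Matrix.mulVec, dotProduct, Fin.sum_univ_three,
        hν.ne', hs.ne'] at h1
  · intro h0
    have := h.π_τ
    simp [h0] at this
  · intro h0
    have := h.π_τ
    simp [h0] at this
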